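/- Let $X$ be a connected smooth manifold with a regular Sasaki structure whose Reeb flow is isomorphic to $\mathbb R$. That is: $\omega$ is a contact form on $X$ with Reeb field $\mathcal A$ (so $\omega(\mathcal A)=1$ and $\iota_{\mathcal A}d\omega=0$); $J$ is an integrable complex structure on $\ker\omega$ such that $d\omega(J\cdot,\cdot)$ is a positive definite Hermitian form on $\ker\omega$; and $\mathcal A$ is complete with flow $T=\{\varphi_t\}_{t\in\mathbb R}\cong\mathbb R$ acting freely and properly on $X$ by diffeomorphisms that preserve $\omega$ and $J$. Extend $J$ to $TX$ by $J\mathcal A=0$ and let $g=\omega\cdot\omega+d\omega(J\cdot,\cdot)$ be the Sasaki metric. Put $$\operatorname{Psh}(X)=\{h\in\operatorname{Diff}(X): h^*\omega=\omega,\ h_*J=Jh_*\text{ on }\ker\omega\},\qquad \operatorname{Psh}^{\pm}(X)=\{h\in\operatorname{Isom}(X,g): h_*\mathcal A=\mathcal A\text{ or }h_*\mathcal A=-\mathcal A\}.$$ Let $(W,\Omega,J)$ be the Kähler quotient of $X$: a Kähler manifold, with Riemannian metric $\Omega(J\cdot,\cdot)$, together with a smooth principal bundle $q:X\to W$ whose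 structure group $\mathbb R$ acts by the Reeb flow, such that $q_*J=Jq_*$ on $\ker\omega$ and $q^*\Omega=d\omega$. Let $\operatorname{Isom}_h(W)$ be the group of holomorphic isometries of $W$, and suppose that $H^1(W;\mathbb R)=0$. Then: 1. There is a unique homomorphism $\phi:\operatorname{Psh}(X)\to\operatorname{Isom}_h(W)$ with $q\circ\tilde h=\phi(\tilde h)\circ q$ for all $\tilde h\in\operatorname{Psh}(X)$, and the sequence $$1\longrightarrow\mathbb R\longrightarrow\operatorname{Psh}(X)\stackrel{\phi}{\longrightarrow}\operatorname{Isom}_h(W)\longrightarrow 1,$$ whose first map is $t\mapsto\varphi_t$, is exact. 2. $\operatorname{Psh}(X)$ acts transitively on $X$ if and only if $\operatorname{Isom}_h(W)$ acts transitively on $W$. 3. If $\mu\in\{1,-1\}$ and $h$ is an isometry of $W$ with $h^*\Omega=\mu\,\Omega$, then there is $\tilde h\in\operatorname{Psh}^{\pm}(X)$ with $q\circ\tilde h=h\circ q$ and $\tilde h^*\omega=\mu\,\omega$, and $\tilde h\in\operatorname{Psh}(X)$ if $\mu=1$. In particular, every holomorphic or anti-holomorphic isometry $h$ of $W$ has a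 lift $\tilde h\in\operatorname{Psh}^{\pm}(X)$, which can be chosen in $\operatorname{Psh}(X)$ if $h$ is holomorphic. -/

import Mathlib

open Set Filter Topology
open scoped Manifold ContDiff

noncomputable section

namespace SasakiGeometry

/-! Manifolds are modelled on a real normed space `E` through the model `𝓘(ℝ, E)`, so they have
no boundary. -/

section Forms

variable (E : Type*) [NormedAddCommGroup E] [NormedSpace ℝ E]
  (M : Type*) [TopologicalSpace M] [ChartedSpace E M]

/-- (Not necessarily smooth) differential `k`-forms on `M`. -/
abbrev DForm (k : ℕ) : Type _ := (x : M) → TangentSpace 𝓘(ℝ, E) x [⋀^Fin k]→L[ℝ] ℝ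

/-- (Not necessarily smooth) vector fields on `M`. -/
abbrev VField : Type _ := (x : M) → TangentSpace 𝓘(ℝ, E) x

/-- (Not necessarily smooth) endomorphism fields of the tangent bundle of `M`. -/
abbrev EndField : Type _ :=
  (x : M) → TangentSpace 𝓘(ℝ, E) x →L[ℝ] TangentSpace 𝓘(ℝ, E) x

/-- The smooth self-diffeomorphisms of `M`. -/
abbrev Diff : Type _ := Diffeomorph 𝓘(ℝ, E) 𝓘(ℝ, E) M M ∞

variable {E M}

/-- The form `α` read in the preferred chart at `x₀`, as a form on (the target in) `E`. -/
def formInChart {k : ℕ} (α : DForm E M k) (x₀ : M) : E → E [⋀^Fin k]→L[ℝ] ℝ := fun y =>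
  (α ((extChartAt 𝓘(ℝ, E) x₀).symm y)).compContinuousLinearMap
    (mfderiv 𝓘(ℝ, E) 𝓘(ℝ, E) (extChartAt 𝓘(ℝ, E) x₀).symm y)

/-- Smoothness of a form: all its chart representatives are smooth. -/
def IsSmoothForm {k : ℕ} (α : DForm E M k) : Prop :=
  ∀ x₀ : M, ContDiffOn ℝ ∞ (formInChart α x₀) (extChartAt 𝓘(ℝ, E) x₀).target

/-- The exterior derivative, computed at `x` in the preferred chart at `x`; the normalization is
`dα (U, V) = U (α V) - V (α U) - α [U, V]`. -/
def extD {k : ℕ} (α : DForm E M k) : DForm E M (k + 1) := fun x =>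
  (extDeriv (formInChart α x) (extChartAt 𝓘(ℝ, E) x x)).compContinuousLinearMap
    (mfderiv 𝓘(ℝ, E) 𝓘(ℝ, E) (extChartAt 𝓘(ℝ, E) x) x)

/-- Pull-back of a form along a map. -/
def pullback {F : Type*} [NormedAddCommGroup F] [NormedSpace ℝ F]
    {N : Type*} [TopologicalSpace N] [ChartedSpace F N] {k : ℕ}
    (f : M → N) (α : DForm F N k) : DForm E M k := fun x =>
  (α (f x)).compContinuousLinearMap (mfderiv 𝓘(ℝ, E) 𝓘(ℝ, F) f x)

theorem pullback_apply_one {F : Type*} [NormedAddCommGroup F] [NormedSpace ℝ F]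
    {N : Type*} [TopologicalSpace N] [ChartedSpace F N]
    (f : M → N) (α : DForm F N 1) (x : M) (v : TangentSpace 𝓘(ℝ, E) x) :
    pullback f α x ![v] = α (f x) ![mfderiv 𝓘(ℝ, E) 𝓘(ℝ, F) f x v] := by
  have : (fun i => mfderiv 𝓘(ℝ, E) 𝓘(ℝ, F) f x (![v] i)) =
      ![mfderiv 𝓘(ℝ, E) 𝓘(ℝ, F) f x v] := by
    funext i
    fin_cases i
    rfl
  exact congrArg (α (f x)) this

/-- Smoothness of a vector field, as a section of the tangent bundle. -/
def IsSmoothVField [IsManifold 𝓘(ℝ, E) ∞ M] (V : VField E M) : Prop :=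
  ContMDiff 𝓘(ℝ, E) 𝓘(ℝ, E).tangent ∞ (fun x => (⟨x, V x⟩ : TangentBundle 𝓘(ℝ, E) M))

/-- Smoothness of an endomorphism field, as a section of the bundle `End (TM)`. -/
def IsSmoothEndField [IsManifold 𝓘(ℝ, E) ∞ M] (J : EndField E M) : Prop :=
  ContMDiff 𝓘(ℝ, E) (𝓘(ℝ, E).prod 𝓘(ℝ, E →L[ℝ] E)) ∞
    (fun x => Bundle.TotalSpace.mk' (E →L[ℝ] E)
      (E := fun x : M => TangentSpace 𝓘(ℝ, E) x →L[ℝ] TangentSpace 𝓘(ℝ, E) x) x (J x))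

theorem formInChart_add {k : ℕ} (α β : DForm E M k) (x₀ : M) :
    formInChart (α + β) x₀ = formInChart α x₀ + formInChart β x₀ := rfl

theorem formInChart_smul {k : ℕ} (c : ℝ) (α : DForm E M k) (x₀ : M) :
    formInChart (c • α) x₀ = c • formInChart α x₀ := rfl

theorem formInChart_zero {k : ℕ} (x₀ : M) :
    formInChart (0 : DForm E M k) x₀ = 0 := rfl

theorem IsSmoothForm.differentiableAt {k : ℕ} {α : DForm E M k} (h : IsSmoothForm α) (x : M) :
    DifferentiableAt ℝ (formInChart α x) (extChartAt 𝓘(ℝ, E) x x) :=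
  ((h x).contDiffAt ((isOpen_extChartAt_target x).mem_nhds
    (mem_extChartAt_target x))).differentiableAt (by simp)

theorem extD_add {k : ℕ} {α β : DForm E M k} (hα : IsSmoothForm α) (hβ : IsSmoothForm β) :
    extD (α + β) = extD α + extD β := by
  funext x
  ext v
  simp only [extD, formInChart_add, Pi.add_apply,
    extDeriv_add (hα.differentiableAt x) (hβ.differentiableAt x)]
  rfl

theorem extD_smul {k : ℕ} (c : ℝ) (α : DForm E M k) : extD (c • α) = c • extD α := by
  funext x
  ext v
  simp only [extD, formInChart_smul, Pi.smul_apply, extDeriv_smul]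
  rfl

variable (E M)

/-- The space of smooth closed `1`-forms. -/
def closedOneForms : Submodule ℝ (DForm E M 1) where
  carrier := {η | IsSmoothForm η ∧ extD η = 0}
  add_mem' := by
    rintro α β ⟨hα, hα'⟩ ⟨hβ, hβ'⟩
    exact ⟨fun x => by rw [formInChart_add]; exact (hα x).add (hβ x),
      by rw [extD_add hα hβ, hα', hβ', add_zero]⟩
  zero_mem' := ⟨fun x => by rw [formInChart_zero]; exact contDiffOn_const,
    by simpa using extD_smul (0 : ℝ) (0 : DForm E M 1)⟩
  smul_mem' := by
    rintro c α ⟨hα, hα'⟩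
    exact ⟨fun x => by rw [formInChart_smul]; exact contDiffOn_const.smul (hα x),
      by rw [extD_smul, hα', smul_zero]⟩

/-- The space of differentials of smooth functions. -/
def exactOneForms : Submodule ℝ (DForm E M 1) where
  carrier := {η | ∃ f : M → ℝ, ContMDiff 𝓘(ℝ, E) 𝓘(ℝ, ℝ) ∞ f ∧
    ∀ (x : M) (v : TangentSpace 𝓘(ℝ, E) x), η x ![v] = mfderiv 𝓘(ℝ, E) 𝓘(ℝ, ℝ) f x v}
  add_mem' := by
    rintro α β ⟨f, hf, hf'⟩ ⟨g, hg, hg'⟩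
    refine ⟨f + g, hf.add hg, fun x v => ?_⟩
    rw [mfderiv_add (hf.mdifferentiableAt (by simp)) (hg.mdifferentiableAt (by simp))]
    exact congrArg₂ (· + ·) (hf' x v) (hg' x v)
  zero_mem' := ⟨fun _ => 0, contMDiff_const, fun x v => by rw [mfderiv_const]; rfl⟩
  smul_mem' := by
    rintro c α ⟨f, hf, hf'⟩
    refine ⟨c • f, (contDiff_const_smul c).contMDiff.comp hf, fun x v => ?_⟩
    rw [const_smul_mfderiv (hf.mdifferentiableAt (by simp))]
    exact congrArg (c • ·) (hf' x v)

instance : HasQuotient (closedOneForms E M) (Submodule ℝ (closedOneForms E M)) :=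
  Submodule.hasQuotient (R := ℝ) (M := closedOneForms E M)

/-- The first real (de Rham) cohomology of `M`: closed modulo exact `1`-forms. -/
abbrev DeRhamH1 : Type _ :=
  closedOneForms E M ⧸ (exactOneForms E M).submoduleOf (closedOneForms E M)

theorem subsingleton_deRhamH1_iff :
    Subsingleton (DeRhamH1 E M) ↔ closedOneForms E M ≤ exactOneForms E M :=
  (Submodule.Quotient.subsingleton_iff (R := ℝ) (M := closedOneForms E M)).trans
    Submodule.submoduleOf_eq_top

end Forms

section Diffeos

variable {E : Type*} [NormedAddCommGroup E] [NormedSpace ℝ E]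
  {M : Type*} [TopologicalSpace M] [ChartedSpace E M]

/-- The diffeomorphism group, with composition as multiplication. -/
instance : Group (Diff E M) where
  mul f g := g.trans f
  one := Diffeomorph.refl 𝓘(ℝ, E) M ∞
  inv f := f.symm
  mul_assoc _ _ _ := rfl
  one_mul _ := rfl
  mul_one _ := rfl
  inv_mul_cancel f := Diffeomorph.ext fun x => f.symm_apply_apply x

/-- The differential of a self-diffeomorphism. -/
abbrev Diff.d (h : Diff E M) (x : M) :
    TangentSpace 𝓘(ℝ, E) x →L[ℝ] TangentSpace 𝓘(ℝ, E) (h x) :=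
  mfderiv 𝓘(ℝ, E) 𝓘(ℝ, E) h x

theorem Diff.d_one (x : M) (v : TangentSpace 𝓘(ℝ, E) x) : Diff.d (1 : Diff E M) x v = v := by
  have : mfderiv 𝓘(ℝ, E) 𝓘(ℝ, E) (id : M → M) x v = v := by rw [mfderiv_id]; rfl
  exact this

theorem Diff.d_mul (f g : Diff E M) (x : M) (v : TangentSpace 𝓘(ℝ, E) x) :
    Diff.d (f * g) x v = Diff.d f (g x) (Diff.d g x v) := by
  have : mfderiv 𝓘(ℝ, E) 𝓘(ℝ, E) (f ∘ g) x v = Diff.d f (g x) (Diff.d g x v) := by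
    rw [mfderiv_comp x (f.mdifferentiable (by simp) (g x)) (g.mdifferentiable (by simp) x)]
    rfl
  exact this

theorem Diff.d_injective (h : Diff E M) (x : M) : Function.Injective (Diff.d h x) := by
  intro u v huv
  have key : ∀ k : Diff E M, k = 1 → Diff.d k x u = Diff.d k x v → u = v := by
    rintro k rfl hk
    rwa [Diff.d_one, Diff.d_one] at hk
  refine key (h⁻¹ * h) (inv_mul_cancel h) ?_
  rw [Diff.d_mul, Diff.d_mul, huv]

/-- `h` preserves the metric tensor `g`, i.e. is a Riemannian isometry when `g` is a Riemannian
metric. -/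
def IsIsometryFor (g : (x : M) → TangentSpace 𝓘(ℝ, E) x → TangentSpace 𝓘(ℝ, E) x → ℝ)
    (h : Diff E M) : Prop :=
  ∀ (x : M) (u v : TangentSpace 𝓘(ℝ, E) x), g (h x) (h.d x u) (h.d x v) = g x u v

theorem IsIsometryFor.one
    (g : (x : M) → TangentSpace 𝓘(ℝ, E) x → TangentSpace 𝓘(ℝ, E) x → ℝ) :
    IsIsometryFor g (1 : Diff E M) := by
  intro x u v
  rw [Diff.d_one, Diff.d_one]
  rfl

theorem IsIsometryFor.mul
    {g : (x : M) → TangentSpace 𝓘(ℝ, E) x → TangentSpace 𝓘(ℝ, E) x → ℝ} {h k : Diff E M}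
    (hh : IsIsometryFor g h) (hk : IsIsometryFor g k) : IsIsometryFor g (h * k) := by
  intro x u v
  rw [Diff.d_mul, Diff.d_mul, ← hk x u v]
  exact hh _ _ _

theorem IsIsometryFor.inv
    {g : (x : M) → TangentSpace 𝓘(ℝ, E) x → TangentSpace 𝓘(ℝ, E) x → ℝ} {h : Diff E M}
    (hh : IsIsometryFor g h) : IsIsometryFor g h⁻¹ := by
  intro x u v
  rw [← hh]
  have key : ∀ k : Diff E M, k = 1 → g (k x) (k.d x u) (k.d x v) = g x u v := by
    rintro k rfl
    exact IsIsometryFor.one g x u v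
  have := key (h * h⁻¹) (mul_inv_cancel h)
  rw [Diff.d_mul, Diff.d_mul] at this
  exact this

theorem pullback_one {k : ℕ} (α : DForm E M k) : pullback (⇑(1 : Diff E M) : M → M) α = α := by
  funext x
  ext v
  have : (fun i => Diff.d (1 : Diff E M) x (v i)) = v := funext fun i => Diff.d_one x (v i)
  exact congrArg (α x) this

theorem pullback_mul {k : ℕ} (f g : Diff E M) (α : DForm E M k) :
    pullback (E := E) ⇑(f * g) α = pullback (E := E) ⇑g (pullback (E := E) ⇑f α) := by
  funext x
  ext v
  have : (fun i => Diff.d (f * g) x (v i)) = fun i => Diff.d f (g x) (Diff.d g x (v i)) :=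
    funext fun i => Diff.d_mul f g x (v i)
  exact congrArg (α (f (g x))) this

end Diffeos

section Structures

/-- A pseudo-Hermitian structure `{η, J}` on `M`, together with its Reeb field `A`. The complex
structure of `ker η` is extended to `TM` by `J A = 0`. Positivity of the Levi form makes `dη`
non-degenerate on `ker η`, so `η` is a contact form. -/
structure PseudoHermitian (E : Type*) [NormedAddCommGroup E] [NormedSpace ℝ E]
    (M : Type*) [TopologicalSpace M] [ChartedSpace E M] [IsManifold 𝓘(ℝ, E) ∞ M] where
  η : DForm E M 1
  smooth_η : IsSmoothForm η
  /-- the Reeb field -/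
  reeb : VField E M
  smooth_reeb : IsSmoothVField reeb
  η_reeb : ∀ x, η x ![reeb x] = 1
  dη_reeb : ∀ x v, extD η x ![reeb x, v] = 0
  J : EndField E M
  smooth_J : IsSmoothEndField J
  J_reeb : ∀ x, J x (reeb x) = 0
  η_J : ∀ x v, η x ![J x v] = 0
  J_J : ∀ x v, η x ![v] = 0 → J x (J x v) = -v
  /-- the Levi form `dη (J ·, ·)` on `ker η` is Hermitian … -/
  levi_hermitian : ∀ x u v, η x ![u] = 0 → η x ![v] = 0 →
    extD η x ![J x u, J x v] = extD η x ![u, v]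
  /-- … and positive definite -/
  levi_pos : ∀ x v, η x ![v] = 0 → v ≠ 0 → 0 < extD η x ![J x v, v]
  /-- `J` is integrable: `[T^{1,0}, T^{1,0}] ⊆ T^{1,0}`, applied to the sections `U - i J U` and
  `V - i J V` of `T^{1,0}` and split into real and imaginary parts -/
  integrable : ∀ U V : VField E M, IsSmoothVField U → IsSmoothVField V →
    (∀ x, η x ![U x] = 0) → (∀ x, η x ![V x] = 0) → ∀ x,
      let re := VectorField.mlieBracket 𝓘(ℝ, E) U V x -
        VectorField.mlieBracket 𝓘(ℝ, E) (fun y => J y (U y)) (fun y => J y (V y)) x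
      let im := VectorField.mlieBracket 𝓘(ℝ, E) U (fun y => J y (V y)) x +
        VectorField.mlieBracket 𝓘(ℝ, E) (fun y => J y (U y)) V x
      η x ![re] = 0 ∧ im = J x re

/-- A Kähler structure `(Ω, J)` on `W`: an integrable almost complex structure `J` and a closed
`J`-invariant `2`-form `Ω` such that `Ω (J ·, ·)` is positive definite. -/
structure KahlerStructure (F : Type*) [NormedAddCommGroup F] [NormedSpace ℝ F]
    (W : Type*) [TopologicalSpace W] [ChartedSpace F W] [IsManifold 𝓘(ℝ, F) ∞ W] where
  Ω : DForm F W 2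
  smooth_Ω : IsSmoothForm Ω
  closed : extD Ω = 0
  J : EndField F W
  smooth_J : IsSmoothEndField J
  J_J : ∀ w v, J w (J w v) = -v
  invariant : ∀ w u v, Ω w ![J w u, J w v] = Ω w ![u, v]
  pos : ∀ w v, v ≠ 0 → 0 < Ω w ![J w v, v]
  /-- the Nijenhuis tensor of `J` vanishes -/
  integrable : ∀ U V : VField F W, IsSmoothVField U → IsSmoothVField V → ∀ w,
    VectorField.mlieBracket 𝓘(ℝ, F) U (fun y => J y (V y)) w +
        VectorField.mlieBracket 𝓘(ℝ, F) (fun y => J y (U y)) V w =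
      J w (VectorField.mlieBracket 𝓘(ℝ, F) U V w -
        VectorField.mlieBracket 𝓘(ℝ, F) (fun y => J y (U y)) (fun y => J y (V y)) w)

end Structures

section Groups

variable {E : Type*} [NormedAddCommGroup E] [NormedSpace ℝ E]
  {X : Type*} [TopologicalSpace X] [ChartedSpace E X] [IsManifold 𝓘(ℝ, E) ∞ X]
  {F : Type*} [NormedAddCommGroup F] [NormedSpace ℝ F]
  {W : Type*} [TopologicalSpace W] [ChartedSpace F W] [IsManifold 𝓘(ℝ, F) ∞ W]

/-- The Riemannian metric `g = η · η + dη ∘ J` of a pseudo-Hermitian structure. -/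
def PseudoHermitian.metric (S : PseudoHermitian E X) (x : X)
    (u v : TangentSpace 𝓘(ℝ, E) x) : ℝ :=
  S.η x ![u] * S.η x ![v] + extD S.η x ![S.J x u, v]

/-- The Riemannian metric `Ω ∘ J` of a Kähler structure. -/
def KahlerStructure.metric (K : KahlerStructure F W) (w : W)
    (u v : TangentSpace 𝓘(ℝ, F) w) : ℝ :=
  K.Ω w ![K.J w u, v]

/-- `Psh (X)`: the diffeomorphisms `h` with `h^* η = η` and `h_* J = J h_*` on `ker η`. -/
def PseudoHermitian.Psh (S : PseudoHermitian E X) : Subgroup (Diff E X) where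
  carrier := {h | pullback h S.η = S.η ∧
    ∀ x v, S.η x ![v] = 0 → h.d x (S.J x v) = S.J (h x) (h.d x v)}
  one_mem' := by
    refine ⟨pullback_one _, fun x v _ => ?_⟩
    rw [Diff.d_one, Diff.d_one]
    rfl
  mul_mem' := by
    rintro f g ⟨hf, hf'⟩ ⟨hg, hg'⟩
    refine ⟨by rw [pullback_mul, hf, hg], fun x v hv => ?_⟩
    rw [Diff.d_mul, Diff.d_mul, hg' x v hv, hf' (g x)]
    · rfl
    · rw [← hg] at hv
      rwa [pullback_apply_one] at hv
  inv_mem' := by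
    rintro f ⟨hf, hf'⟩
    have hinv : pullback ⇑(f⁻¹ : Diff E X) S.η = S.η := by
      conv_lhs => rw [← hf]
      rw [← pullback_mul, mul_inv_cancel, pullback_one]
    refine ⟨hinv, fun x v hv => ?_⟩
    apply Diff.d_injective f
    rw [hf']
    · have key : ∀ k : Diff E X, k = 1 → k.d x (S.J x v) = S.J (k x) (k.d x v) := by
        rintro k rfl
        rw [Diff.d_one, Diff.d_one]
        rfl
      have := key (f * f⁻¹) (mul_inv_cancel f)
      rw [Diff.d_mul, Diff.d_mul] at this
      exact this
    · rw [← hinv] at hv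
      rwa [pullback_apply_one] at hv

/-- `Psh^± (X)`: the isometries `h` of `X` with `h_* A = A` or `h_* A = -A`. -/
def PseudoHermitian.PshPM (S : PseudoHermitian E X) : Set (Diff E X) :=
  {h | IsIsometryFor S.metric h ∧
    ((∀ x, h.d x (S.reeb x) = S.reeb (h x)) ∨ (∀ x, h.d x (S.reeb x) = -S.reeb (h x)))}

/-- `Isom_h (W)`: the holomorphic isometries of a Kähler manifold. -/
def KahlerStructure.IsomH (K : KahlerStructure F W) : Subgroup (Diff F W) where
  carrier := {h | IsIsometryFor K.metric h ∧ ∀ w v, h.d w (K.J w v) = K.J (h w) (h.d w v)}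
  one_mem' := by
    refine ⟨IsIsometryFor.one _, fun x v => ?_⟩
    rw [Diff.d_one, Diff.d_one]
    rfl
  mul_mem' := by
    rintro f g ⟨hf, hf'⟩ ⟨hg, hg'⟩
    refine ⟨hf.mul hg, fun x v => ?_⟩
    rw [Diff.d_mul, Diff.d_mul, hg' x v, hf' (g x)]
    rfl
  inv_mem' := by
    rintro f ⟨hf, hf'⟩
    refine ⟨hf.inv, fun x v => ?_⟩
    apply Diff.d_injective f
    rw [hf']
    have key : ∀ k : Diff F W, k = 1 → k.d x (K.J x v) = K.J (k x) (k.d x v) := by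
      rintro k rfl
      rw [Diff.d_one, Diff.d_one]
      rfl
    have := key (f * f⁻¹) (mul_inv_cancel f)
    rw [Diff.d_mul, Diff.d_mul] at this
    exact this

/-- `Isom_h^± (W)`: the isometries of a Kähler manifold that are holomorphic or
anti-holomorphic. -/
def KahlerStructure.IsomHPM (K : KahlerStructure F W) : Set (Diff F W) :=
  {h | IsIsometryFor K.metric h ∧
    ((∀ w v, h.d w (K.J w v) = K.J (h w) (h.d w v)) ∨
      (∀ w v, h.d w (K.J w v) = -K.J (h w) (h.d w v)))}

end Groups

section Regular

/-- A regular Sasaki structure whose Reeb flow `T` is isomorphic to `ℝ`: a pseudo-Hermitian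
structure whose Reeb field has a global flow `T = {φ_t}` with `T ≤ Psh (X)`, such that `t ↦ φ_t`
is injective and `T ≅ ℝ` acts freely and properly. -/
structure RegularSasaki (E : Type*) [NormedAddCommGroup E] [NormedSpace ℝ E]
    (X : Type*) [TopologicalSpace X] [ChartedSpace E X] [IsManifold 𝓘(ℝ, E) ∞ X]
    extends PseudoHermitian E X where
  /-- the flow of the Reeb field -/
  flow : Flow ℝ X
  smooth_flow : ContMDiff (𝓘(ℝ, ℝ).prod 𝓘(ℝ, E)) 𝓘(ℝ, E) ∞
    (fun p : ℝ × X => flow p.1 p.2)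
  flow_reeb : ∀ x, IsMIntegralCurve (I := 𝓘(ℝ, E)) (fun t => flow t x) reeb
  flow_η : ∀ t, pullback (flow t) η = η
  flow_J : ∀ t x v, η x ![v] = 0 →
    mfderiv 𝓘(ℝ, E) 𝓘(ℝ, E) (flow t) x (J x v) =
      J (flow t x) (mfderiv 𝓘(ℝ, E) 𝓘(ℝ, E) (flow t) x v)
  /-- `t ↦ φ_t` is injective, so `T` is isomorphic to `ℝ` -/
  flow_line : ∀ t, (∀ x, flow t x = x) → t = 0
  /-- `T` acts freely -/
  flow_free : ∀ t x, flow t x = x → ∀ y, flow t y = y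
  /-- `T` acts properly -/
  flow_proper : IsProperMap (fun p : ℝ × X => (flow p.1 p.2, p.2))

variable {E : Type*} [NormedAddCommGroup E] [NormedSpace ℝ E]
  {X : Type*} [TopologicalSpace X] [ChartedSpace E X] [IsManifold 𝓘(ℝ, E) ∞ X]
  {F : Type*} [NormedAddCommGroup F] [NormedSpace ℝ F]
  {W : Type*} [TopologicalSpace W] [ChartedSpace F W] [IsManifold 𝓘(ℝ, F) ∞ W]

/-- The diffeomorphism `φ_t`. -/
def RegularSasaki.flowDiff (S : RegularSasaki E X) (t : ℝ) : Diff E X where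
  toFun := S.flow t
  invFun := S.flow (-t)
  left_inv x := by rw [← S.flow.map_add, neg_add_cancel, S.flow.map_zero_apply]
  right_inv x := by rw [← S.flow.map_add, add_neg_cancel, S.flow.map_zero_apply]
  contMDiff_toFun := S.smooth_flow.comp (contMDiff_const.prodMk contMDiff_id)
  contMDiff_invFun := S.smooth_flow.comp (contMDiff_const.prodMk contMDiff_id)

/-- The homomorphism `ℝ → Psh (X)`, `t ↦ φ_t`, given by the Reeb flow. -/
def RegularSasaki.reebHom (S : RegularSasaki E X) : Multiplicative ℝ →* S.Psh where
  toFun t := ⟨S.flowDiff t.toAdd, S.flow_η t.toAdd, S.flow_J t.toAdd⟩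
  map_one' := Subtype.ext (Diffeomorph.ext fun x => S.flow.map_zero_apply x)
  map_mul' s t := Subtype.ext (Diffeomorph.ext fun x => S.flow.map_add s.toAdd t.toAdd x)

/-- `q : X → W` is a smooth principal bundle for the action of `ℝ` on `X` by the flow `φ`:
`q` is invariant, and over suitable neighbourhoods `U` of any point of `W` there are equivariant
diffeomorphisms `q⁻¹ U ≃ ℝ × U` over `U`. -/
structure IsPrincipalLineBundle (φ : Flow ℝ X) (q : X → W) : Prop where
  smooth : ContMDiff 𝓘(ℝ, E) 𝓘(ℝ, F) ∞ q
  invariant : ∀ t x, q (φ t x) = q x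
  locally_trivial : ∀ w : W, ∃ (U : Set W) (e : OpenPartialHomeomorph X (ℝ × W)),
    IsOpen U ∧ w ∈ U ∧ e.source = q ⁻¹' U ∧ e.target = univ ×ˢ U ∧
    ContMDiffOn 𝓘(ℝ, E) (𝓘(ℝ, ℝ).prod 𝓘(ℝ, F)) ∞ e e.source ∧
    ContMDiffOn (𝓘(ℝ, ℝ).prod 𝓘(ℝ, F)) 𝓘(ℝ, E) ∞ e.symm e.target ∧
    ∀ x ∈ e.source, (e x).2 = q x ∧ ∀ t, (e (φ t x)).1 = t + (e x).1

/-- `(W, Ω, J)` is, with projection `q`, the Kähler quotient of the regular Sasaki manifold `X`: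
`q` is a principal bundle for the Reeb flow (so that `W = X / T`), `q_*` is holomorphic on
`ker η`, and `q^* Ω = dη`. -/
structure IsKahlerQuotient (S : RegularSasaki E X) (K : KahlerStructure F W) (q : X → W) :
    Prop where
  bundle : IsPrincipalLineBundle (E := E) (F := F) S.flow q
  holomorphic : ∀ x v, S.η x ![v] = 0 →
    mfderiv 𝓘(ℝ, E) 𝓘(ℝ, F) q x (S.J x v) = K.J (q x) (mfderiv 𝓘(ℝ, E) 𝓘(ℝ, F) q x v)
  curvature : pullback q K.Ω = extD S.η

end Regular

end SasakiGeometry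

end

open SasakiGeometry

/-! A principal `ℝ`-bundle is trivial: a partition of unity averages local fibre coordinates into a
global `s : X → ℝ` with `s (φ_t x) = t + s x`. The zeros of `s` form a smooth section `σ` of `q`.
This identifies `X` with `ℝ × W` and gives `η = ds + q^*β`, where `β = σ^*η` satisfies `dβ = Ω`.

If `h^*Ω = μ Ω`, then `h^*β - μ β` is closed, hence equal to some `dl` because `H¹(W; ℝ) = 0`. The
map `(s, w) ↦ (μ s - l w, h w)` then pulls `η` back to `μ ds - q^*dl + q^*h^*β = μ η`
(`IsKahlerQuotient.exists_lift`). Compatibility with the metric and with `J` comes for free: `dη`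
and `J` are induced from `W`, and a tangent vector of `X` is determined by its value under `η` and
its image under `q_*`.

Conversely, a map preserving `η` preserves the Reeb field, which `η` determines, so it permutes the
flow lines and descends to `W` (`IsKahlerQuotient.exists_descent`). A map over the identity has the
form `x ↦ φ_{f x} x` and pulls `η` back to `η + df`; if it preserves `η`, then `f` is constant, so
it belongs to the flow (`IsKahlerQuotient.exists_flow_of_lift_id`). Exactness follows, and
transitivity passes up from `W` by correcting a lift along the fibre. -/

namespace SasakiGeometry

/-! ### Pull-back of forms, exterior derivative and smoothness in charts -/

section Forms

variable {E : Type*} [NormedAddCommGroup E] [NormedSpace ℝ E]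
  {M : Type*} [TopologicalSpace M] [ChartedSpace E M]
  {F : Type*} [NormedAddCommGroup F] [NormedSpace ℝ F]
  {N : Type*} [TopologicalSpace N] [ChartedSpace F N]

/-- Evaluation of a form is compatible with equality of base points, the tangent spaces being
identified with the model space. -/
theorem DForm.eval_congr {k : ℕ} (α : DForm F N k) {p p' : N} (h : p = p') {u v : Fin k → F}
    (huv : u = v) : (α p : F [⋀^Fin k]→L[ℝ] ℝ) u = (α p' : F [⋀^Fin k]→L[ℝ] ℝ) v := by
  subst h huv
  rfl

variable [IsManifold 𝓘(ℝ, E) ∞ M] [IsManifold 𝓘(ℝ, F) ∞ N]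

variable (E F) in
/-- The map `f` read in the preferred charts at `x₀` and `z₀`. -/
noncomputable def readInCharts (f : M → N) (x₀ : M) (z₀ : N) : E → F :=
  extChartAt 𝓘(ℝ, F) z₀ ∘ f ∘ (extChartAt 𝓘(ℝ, E) x₀).symm

theorem contMDiffAt_extChartAt_symm {x₀ : M} {y : E} (hy : y ∈ (extChartAt 𝓘(ℝ, E) x₀).target) :
    ContMDiffAt 𝓘(ℝ, E) 𝓘(ℝ, E) ∞ (extChartAt 𝓘(ℝ, E) x₀).symm y :=
  (contMDiffOn_extChartAt_symm x₀).contMDiffAt ((isOpen_extChartAt_target x₀).mem_nhds hy)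

theorem contDiffAt_readInCharts {f : M → N} (hf : ContMDiff 𝓘(ℝ, E) 𝓘(ℝ, F) ∞ f) {x₀ : M} {z₀ : N}
    {y : E} (hy : y ∈ (extChartAt 𝓘(ℝ, E) x₀).target)
    (hz : f ((extChartAt 𝓘(ℝ, E) x₀).symm y) ∈ (extChartAt 𝓘(ℝ, F) z₀).source) :
    ContDiffAt ℝ ∞ (readInCharts E F f x₀ z₀) y := by
  rw [← contMDiffAt_iff_contDiffAt]
  refine ContMDiffAt.comp y ?_ ((hf _).comp y (contMDiffAt_extChartAt_symm hy))
  exact contMDiffAt_extChartAt' (by simpa using hz)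

theorem formInChart_pullback {k : ℕ} (α : DForm F N k) {f : M → N}
    (hf : ContMDiff 𝓘(ℝ, E) 𝓘(ℝ, F) ∞ f) {x₀ : M} {z₀ : N}
    {y : E} (hy : y ∈ (extChartAt 𝓘(ℝ, E) x₀).target)
    (hz : f ((extChartAt 𝓘(ℝ, E) x₀).symm y) ∈ (extChartAt 𝓘(ℝ, F) z₀).source) :
    formInChart (pullback (E := E) f α) x₀ y =
      (formInChart α z₀ (readInCharts E F f x₀ z₀ y)).compContinuousLinearMap
        (fderiv ℝ (readInCharts E F f x₀ z₀) y) := by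
  have hsymm := (contMDiffAt_extChartAt_symm hy).mdifferentiableAt (by simp)
  have hfd : MDifferentiableAt 𝓘(ℝ, E) 𝓘(ℝ, F) f ((extChartAt 𝓘(ℝ, E) x₀).symm y) :=
    (hf _).mdifferentiableAt (by simp)
  have hg := (contDiffAt_readInCharts hf hy hz).differentiableAt (by simp)
  have hgt : readInCharts E F f x₀ z₀ y ∈ (extChartAt 𝓘(ℝ, F) z₀).target :=
    (extChartAt 𝓘(ℝ, F) z₀).map_source hz
  -- The chart at `z₀` is invertible only on its source, so this holds near `y` only; that suffices
  -- to compare derivatives.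
  have hev : (extChartAt 𝓘(ℝ, F) z₀).symm ∘ readInCharts E F f x₀ z₀ =ᶠ[𝓝 y]
      f ∘ (extChartAt 𝓘(ℝ, E) x₀).symm := by
    have hc : ContinuousAt (f ∘ (extChartAt 𝓘(ℝ, E) x₀).symm) y :=
      (hfd.comp y hsymm).continuousAt
    filter_upwards [hc.preimage_mem_nhds ((isOpen_extChartAt_source z₀).mem_nhds hz)] with t ht
    exact (extChartAt 𝓘(ℝ, F) z₀).left_inv ht
  have hd := hev.mfderiv_eq (I := 𝓘(ℝ, E)) (I' := 𝓘(ℝ, F))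
  rw [mfderiv_comp y ((contMDiffAt_extChartAt_symm hgt).mdifferentiableAt (by simp))
    hg.mdifferentiableAt, mfderiv_comp y hfd hsymm, mfderiv_eq_fderiv] at hd
  ext v
  refine DForm.eval_congr α hev.eq_of_nhds.symm (funext fun i => ?_)
  exact (congrArg (fun L : E →L[ℝ] F => L (v i)) hd).symm

/-- In the preferred charts at `x` and `f x` this is naturality of `extDeriv` on normed spaces; the
chain rule then converts the differential of the chart expression of `f` into that of `f`. -/
theorem extD_pullback {k : ℕ} {α : DForm F N k} (hα : IsSmoothForm α) {f : M → N}
    (hf : ContMDiff 𝓘(ℝ, E) 𝓘(ℝ, F) ∞ f) :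
    extD (pullback (E := E) f α) = pullback f (extD α) := by
  funext x
  have hx := mem_extChartAt_target (I := 𝓘(ℝ, E)) x
  have hxs : (extChartAt 𝓘(ℝ, E) x).symm (extChartAt 𝓘(ℝ, E) x x) = x :=
    extChartAt_to_inv x
  have hz : f ((extChartAt 𝓘(ℝ, E) x).symm (extChartAt 𝓘(ℝ, E) x x)) ∈
      (extChartAt 𝓘(ℝ, F) (f x)).source := by
    rw [hxs]; exact mem_extChartAt_source (f x)
  have hgx : readInCharts E F f x (f x) (extChartAt 𝓘(ℝ, E) x x) = extChartAt 𝓘(ℝ, F) (f x) (f x) := by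
    simp only [readInCharts, Function.comp_apply, hxs]
  have hev : formInChart (pullback (E := E) f α) x =ᶠ[𝓝 (extChartAt 𝓘(ℝ, E) x x)] fun y =>
      (formInChart α (f x) (readInCharts E F f x (f x) y)).compContinuousLinearMap
        (fderiv ℝ (readInCharts E F f x (f x)) y) := by
    have hc : ContinuousAt (f ∘ (extChartAt 𝓘(ℝ, E) x).symm) (extChartAt 𝓘(ℝ, E) x x) :=
      ((hf _).comp _ (contMDiffAt_extChartAt_symm hx)).continuousAt
    filter_upwards [(isOpen_extChartAt_target x).mem_nhds hx,
      hc.preimage_mem_nhds ((isOpen_extChartAt_source (f x)).mem_nhds hz)] with y hy hy'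
    exact formInChart_pullback α hf hy hy'
  have hg := contDiffAt_readInCharts hf hx hz
  have key : extDeriv (formInChart (pullback (E := E) f α) x) (extChartAt 𝓘(ℝ, E) x x) =
      (extDeriv (formInChart α (f x)) (extChartAt 𝓘(ℝ, F) (f x) (f x))).compContinuousLinearMap
        (fderiv ℝ (readInCharts E F f x (f x)) (extChartAt 𝓘(ℝ, E) x x)) := by
    rw [hev.extDeriv_eq, extDeriv_pullback (r := ∞) _ hg
      (by rw [minSmoothness_of_isRCLikeNormedField]; exact WithTop.coe_le_coe.2 le_top), hgx]
    rw [hgx]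
    exact hα.differentiableAt (f x)
  have hev' : readInCharts E F f x (f x) ∘ extChartAt 𝓘(ℝ, E) x =ᶠ[𝓝 x]
      extChartAt 𝓘(ℝ, F) (f x) ∘ f := by
    filter_upwards [extChartAt_source_mem_nhds (I := 𝓘(ℝ, E)) x] with t ht
    simp only [readInCharts, Function.comp_apply, (extChartAt 𝓘(ℝ, E) x).left_inv ht]
  have hd := hev'.mfderiv_eq (I := 𝓘(ℝ, E)) (I' := 𝓘(ℝ, F))
  rw [mfderiv_comp x (hg.differentiableAt (by simp)).mdifferentiableAt
      ((contMDiffAt_extChartAt (n := ∞)).mdifferentiableAt (by simp)),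
    mfderiv_comp x ((contMDiffAt_extChartAt (n := ∞)).mdifferentiableAt (by simp))
      ((hf x).mdifferentiableAt (by simp)), mfderiv_eq_fderiv] at hd
  ext v
  simp only [extD, pullback, key]
  change (extDeriv (formInChart α (f x)) (extChartAt 𝓘(ℝ, F) (f x) (f x))) _ =
    (extDeriv (formInChart α (f x)) (extChartAt 𝓘(ℝ, F) (f x) (f x))) _
  congr 1
  funext i
  exact congrArg (fun L : E →L[ℝ] F => L (v i)) hd

/-- In degree one, alternating maps are isometric to linear functionals, and the pull-back becomes a
composition of continuous linear maps. -/
theorem contDiffAt_compContinuousLinearMap_one {a : E → F [⋀^Fin 1]→L[ℝ] ℝ} {L : E → E →L[ℝ] F}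
    {y : E} (ha : ContDiffAt ℝ ∞ a y) (hL : ContDiffAt ℝ ∞ L y) :
    ContDiffAt ℝ ∞ (fun t => (a t).compContinuousLinearMap (L t)) y := by
  let eF := ContinuousAlternatingMap.ofSubsingletonLIE (𝕜 := ℝ) (E := F) (F := ℝ) (0 : Fin 1)
  let eE := ContinuousAlternatingMap.ofSubsingletonLIE (𝕜 := ℝ) (E := E) (F := ℝ) (0 : Fin 1)
  have h : ContDiffAt ℝ ∞ (fun t => eE ((eF.symm (a t)).comp (L t))) y :=
    eE.contDiff.contDiffAt.comp y ((eF.symm.contDiff.contDiffAt.comp y ha).clm_comp hL)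
  refine h.congr_of_eventuallyEq (Eventually.of_forall fun t => ?_)
  ext v
  have hv : (fun i => L t (v i)) = fun _ : Fin 1 => L t (v 0) :=
    funext fun i => by rw [Subsingleton.elim i 0]
  exact congrArg (a t) hv

theorem IsSmoothForm.pullback {α : DForm F N 1} (hα : IsSmoothForm α) {f : M → N}
    (hf : ContMDiff 𝓘(ℝ, E) 𝓘(ℝ, F) ∞ f) : IsSmoothForm (SasakiGeometry.pullback (E := E) f α) := by
  intro x₀ y hy
  set z₀ := f ((extChartAt 𝓘(ℝ, E) x₀).symm y) with hz₀
  have hz : f ((extChartAt 𝓘(ℝ, E) x₀).symm y) ∈ (extChartAt 𝓘(ℝ, F) z₀).source :=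
    mem_extChartAt_source z₀
  have hg := contDiffAt_readInCharts hf hy hz
  have hgt : readInCharts E F f x₀ z₀ y ∈ (extChartAt 𝓘(ℝ, F) z₀).target :=
    (extChartAt 𝓘(ℝ, F) z₀).map_source hz
  have hα' := (hα z₀).contDiffAt ((isOpen_extChartAt_target z₀).mem_nhds hgt)
  refine (ContDiffAt.congr_of_eventuallyEq (contDiffAt_compContinuousLinearMap_one
    (hα'.comp y hg) (hg.fderiv_right (m := ∞) (by simp))) ?_).contDiffWithinAt
  have hc : ContinuousAt (f ∘ (extChartAt 𝓘(ℝ, E) x₀).symm) y :=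
    ((hf _).comp _ (contMDiffAt_extChartAt_symm hy)).continuousAt
  filter_upwards [(isOpen_extChartAt_target x₀).mem_nhds hy,
    hc.preimage_mem_nhds ((isOpen_extChartAt_source z₀).mem_nhds hz)] with t ht ht'
  exact formInChart_pullback α hf ht ht'

/-- A function with vanishing differential on a connected manifold is constant. -/
theorem eq_of_mfderiv_eq_zero [ConnectedSpace M] {f : M → ℝ}
    (hf : ContMDiff 𝓘(ℝ, E) 𝓘(ℝ, ℝ) ∞ f)
    (h : ∀ x (v : TangentSpace 𝓘(ℝ, E) x), mfderiv 𝓘(ℝ, E) 𝓘(ℝ, ℝ) f x v = (0 : ℝ)) (x y : M) :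
    f x = f y := by
  refine IsLocallyConstant.apply_eq_of_preconnectedSpace ?_ x y
  rw [IsLocallyConstant.iff_eventually_eq]
  intro x
  -- A ball in the chart target is connected, so vanishing of the derivative there gives local
  -- constancy.
  obtain ⟨r, hr, hball⟩ := Metric.isOpen_iff.1 (isOpen_extChartAt_target (I := 𝓘(ℝ, E)) x) _
    (mem_extChartAt_target x)
  have hdiff : ∀ y ∈ (extChartAt 𝓘(ℝ, E) x).target,
      HasFDerivAt (f ∘ (extChartAt 𝓘(ℝ, E) x).symm) (0 : E →L[ℝ] ℝ) y := by
    intro y hy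
    have h1 := (hf ((extChartAt 𝓘(ℝ, E) x).symm y)).mdifferentiableAt (by simp)
    have h2 := (contMDiffAt_extChartAt_symm hy).mdifferentiableAt (by simp)
    have h3 := (h1.comp y h2).differentiableAt.hasFDerivAt
    have h4 : fderiv ℝ (f ∘ (extChartAt 𝓘(ℝ, E) x).symm) y = 0 := by
      rw [← mfderiv_eq_fderiv, mfderiv_comp y h1 h2]
      ext v
      exact h _ _
    rwa [h4] at h3
  have hc := (continuousAt_extChartAt (I := 𝓘(ℝ, E)) x).preimage_mem_nhds
    (Metric.ball_mem_nhds _ hr)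
  filter_upwards [hc, extChartAt_source_mem_nhds (I := 𝓘(ℝ, E)) x] with y hy hys
  have := Metric.isOpen_ball.is_const_of_fderiv_eq_zero (𝕜 := ℝ)
    (convex_ball _ r).isPreconnected
    (fun z hz => (hdiff z (hball hz)).differentiableAt.differentiableWithinAt)
    (fun z hz => (hdiff z (hball hz)).fderiv) hy (Metric.mem_ball_self hr)
  simpa only [Function.comp_apply, (extChartAt 𝓘(ℝ, E) x).left_inv hys, extChartAt_to_inv] using this

end Forms

/-! ### Triviality of principal line bundles -/

section Bundle

variable {E : Type*} [NormedAddCommGroup E] [NormedSpace ℝ E]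
  {X : Type*} [TopologicalSpace X] [ChartedSpace E X]
  {F : Type*} [NormedAddCommGroup F] [NormedSpace ℝ F]
  {W : Type*} [TopologicalSpace W] [ChartedSpace F W]
  {φ : Flow ℝ X} {q : X → W}

theorem IsPrincipalLineBundle.surjective (hb : IsPrincipalLineBundle (E := E) (F := F) φ q) :
    Function.Surjective q := by
  intro w
  obtain ⟨U, e, -, hwU, -, het, -, -, he⟩ := hb.locally_trivial w
  have hw : ((0 : ℝ), w) ∈ e.target := by rw [het]; exact ⟨mem_univ _, hwU⟩
  refine ⟨e.symm (0, w), ?_⟩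
  rw [← (he _ (e.map_target hw)).1, e.right_inv hw]

theorem IsPrincipalLineBundle.exists_flow_eq (hb : IsPrincipalLineBundle (E := E) (F := F) φ q)
    {x y : X} (h : q x = q y) : ∃ t, φ t x = y := by
  obtain ⟨U, e, -, hU, hes, -, -, -, he⟩ := hb.locally_trivial (q x)
  have hmem : ∀ z, q z = q x → z ∈ e.source := fun z hz => by
    rw [hes, mem_preimage, hz]; exact hU
  have hx := hmem x rfl
  have hy := hmem y h.symm
  -- The time is the difference of the two fibre coordinates; after flowing, both coordinates agree
  -- and `e` is injective.
  have ht := hmem (φ ((e y).1 - (e x).1) x) (hb.invariant _ _)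
  refine ⟨(e y).1 - (e x).1, e.injOn ht hy (Prod.ext ?_ ?_)⟩
  · rw [(he x hx).2, sub_add_cancel]
  · rw [(he _ ht).1, (he y hy).1, hb.invariant, h]

/-- A principal line bundle has a global smooth fibre coordinate. -/
theorem IsPrincipalLineBundle.exists_equivariant [FiniteDimensional ℝ F]
    [IsManifold 𝓘(ℝ, F) ∞ W] [T2Space W] [SecondCountableTopology W]
    (hb : IsPrincipalLineBundle (E := E) (F := F) φ q) :
    ∃ s : X → ℝ, ContMDiff 𝓘(ℝ, E) 𝓘(ℝ, ℝ) ∞ s ∧ ∀ t x, s (φ t x) = t + s x := by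
  choose U e hUo hU hes het hsm hsm' he using hb.locally_trivial
  have : LocallyCompactSpace W := ChartedSpace.locallyCompactSpace F W
  obtain ⟨ρ, hρ⟩ := SmoothPartitionOfUnity.exists_isSubordinate 𝓘(ℝ, F) (s := (univ : Set W))
    isClosed_univ U hUo (fun w _ => mem_iUnion.2 ⟨w, hU w⟩)
  -- The partition of unity is pulled back from `W`, so its functions are constant along the flow.
  let ρ' : SmoothPartitionOfUnity W 𝓘(ℝ, E) X univ :=
    { toFun := fun i => ⟨fun x => ρ i (q x), (ρ i).contMDiff.comp hb.smooth⟩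
      locallyFinite' := ρ.locallyFinite.preimage_continuous hb.smooth.continuous
      nonneg' := fun i x => ρ.nonneg i (q x)
      sum_eq_one' := fun x _ => ρ.sum_eq_one (mem_univ (q x))
      sum_le_one' := fun x => ρ.sum_le_one (q x) }
  have hsub : ∀ i, tsupport (ρ' i) ⊆ (e i).source := fun i => by
    rw [hes]
    refine (closure_minimal ?_ ((isClosed_tsupport (ρ i)).preimage hb.smooth.continuous)).trans
      (preimage_mono (hρ i))
    exact fun x hx => subset_tsupport (ρ i) hx
  refine ⟨fun x => ∑ᶠ i, ρ' i x • (e i x).1, ρ'.contMDiff_finsum_smul fun i x hx => ?_,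
    fun t x => ?_⟩
  · exact (contMDiff_fst.comp_contMDiffOn (hsm i)).contMDiffAt ((e i).open_source.mem_nhds (hsub i hx))
  · have hinv : ∀ i, ρ' i (φ t x) = ρ' i x := fun i =>
      congrArg (ρ i) (hb.invariant t x)
    have hfin : (Function.support fun i => ρ' i x).Finite := ρ'.locallyFinite.point_finite x
    -- Equivariance of `e i` is available only on its source; elsewhere `ρ' i x` vanishes. Summing
    -- with `∑ ρ' i x = 1` turns the increments into `t`.
    have hterm : ∀ i, ρ' i (φ t x) • (e i (φ t x)).1 = ρ' i x * t + ρ' i x • (e i x).1 := by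
      intro i
      rw [hinv]
      by_cases h0 : ρ' i x = 0
      · simp [h0]
      · rw [(he i x (hsub i (subset_tsupport _ h0))).2 t]
        simp only [smul_eq_mul]
        ring
    change ∑ᶠ i, ρ' i (φ t x) • (e i (φ t x)).1 = t + ∑ᶠ i, ρ' i x • (e i x).1
    rw [finsum_congr hterm, finsum_add_distrib, ← finsum_mul, ρ'.sum_eq_one (mem_univ x), one_mul]
    · exact hfin.subset (Function.support_mul_subset_left _ _)
    · exact hfin.subset (Function.support_mul_subset_left _ _)

/-- The global section on which a given fibre coordinate vanishes. -/
theorem IsPrincipalLineBundle.exists_section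
    (hb : IsPrincipalLineBundle (E := E) (F := F) φ q)
    (hφ : ContMDiff (𝓘(ℝ, ℝ).prod 𝓘(ℝ, E)) 𝓘(ℝ, E) ∞ (fun p : ℝ × X => φ p.1 p.2))
    {s : X → ℝ} (hs : ContMDiff 𝓘(ℝ, E) 𝓘(ℝ, ℝ) ∞ s) (hsφ : ∀ t x, s (φ t x) = t + s x) :
    ∃ σ : W → X, ContMDiff 𝓘(ℝ, F) 𝓘(ℝ, E) ∞ σ ∧ (∀ w, q (σ w) = w) ∧ (∀ w, s (σ w) = 0) ∧
      ∀ x, φ (s x) (σ (q x)) = x := by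
  choose r hr using hb.surjective
  -- Sliding `x` along its orbit to the point where `s` vanishes is constant on fibres, so it
  -- induces `σ` from any set-theoretic choice of preimages.
  let p : X → X := fun x => φ (-s x) x
  have hp : ContMDiff 𝓘(ℝ, E) 𝓘(ℝ, E) ∞ p := hφ.comp (hs.neg.prodMk contMDiff_id)
  have hpt : ∀ t x, p (φ t x) = p x := by
    intro t x
    simp only [p]
    rw [hsφ, ← φ.map_add]
    congr 1
    ring
  have hpq : ∀ {x y}, q x = q y → p x = p y := by
    intro x y h
    obtain ⟨t, rfl⟩ := hb.exists_flow_eq h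
    exact (hpt t x).symm
  refine ⟨fun w => p (r w), fun w => ?_, fun w => ?_, fun w => ?_, fun x => ?_⟩
  · obtain ⟨U, e, hUo, hU, -, het, -, hsm, he⟩ := hb.locally_trivial w
    have hmem : ∀ z ∈ U, ((0 : ℝ), z) ∈ e.target := fun z hz => by
      rw [het]; exact ⟨mem_univ _, hz⟩
    have h1 : ContMDiffAt 𝓘(ℝ, F) 𝓘(ℝ, E) ∞ (fun z => e.symm ((0 : ℝ), z)) w :=
      (hsm.contMDiffAt (e.open_target.mem_nhds (hmem w hU))).comp w
        (contMDiffAt_const.prodMk contMDiffAt_id)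
    -- Near `w` the arbitrary preimages `r` may be replaced by the smooth local section `e.symm (0,
    -- ·)`.
    refine ((hp _).comp w h1).congr_of_eventuallyEq ?_
    filter_upwards [hUo.mem_nhds hU] with z hz
    refine hpq ?_
    rw [hr, ← (he _ (e.map_target (hmem z hz))).1, e.right_inv (hmem z hz)]
  · exact (hb.invariant _ _).trans (hr w)
  · exact (hsφ _ _).trans (neg_add_cancel _)
  · change φ (s x) (p (r (q x))) = x
    rw [hpq (hr (q x))]
    simp only [p]
    rw [← φ.map_add, add_neg_cancel, φ.map_zero_apply]

end Bundle

/-! ### Linear algebra of one- and two-forms -/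

section Linear

variable {E : Type*} [NormedAddCommGroup E] [NormedSpace ℝ E]
  {M : Type*} [TopologicalSpace M] [ChartedSpace E M]

/-- The values of a `1`-form as linear maps. -/
noncomputable def DForm.lin (α : DForm E M 1) (x : M) : TangentSpace 𝓘(ℝ, E) x →ₗ[ℝ] ℝ where
  toFun v := α x ![v]
  map_add' u v := ContinuousAlternatingMap.vecCons_add (α x) ![] u v
  map_smul' c v := ContinuousAlternatingMap.vecCons_smul (α x) ![] c v

theorem DForm.lin_apply (α : DForm E M 1) (x : M) (v : TangentSpace 𝓘(ℝ, E) x) :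
    α x ![v] = α.lin x v := rfl

theorem DForm.two_swap (α : DForm E M 2) (x : M) (u v : TangentSpace 𝓘(ℝ, E) x) :
    α x ![u, v] = -α x ![v, u] := by
  have h := (α x).toAlternatingMap.map_swap ![v, u] (i := 0) (j := 1) (by simp)
  have h' : ![v, u] ∘ (Equiv.swap (0 : Fin 2) 1) = ![u, v] := by
    funext i; fin_cases i <;> rfl
  rw [h'] at h
  exact h

/-- The values of a `2`-form as bilinear maps. -/
noncomputable def DForm.bilin (α : DForm E M 2) (x : M) :
    TangentSpace 𝓘(ℝ, E) x →ₗ[ℝ] TangentSpace 𝓘(ℝ, E) x →ₗ[ℝ] ℝ :=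
  LinearMap.mk₂ ℝ (fun u v => α x ![u, v])
    (fun u u' v => ContinuousAlternatingMap.vecCons_add (α x) ![v] u u')
    (fun c u v => ContinuousAlternatingMap.vecCons_smul (α x) ![v] c u)
    (fun u v v' => by
      rw [α.two_swap, α.two_swap x u v, α.two_swap x u v', ← neg_add]
      exact congrArg _ (ContinuousAlternatingMap.vecCons_add (α x) ![u] v v'))
    (fun c u v => by
      rw [α.two_swap, α.two_swap x u v, smul_neg]
      exact congrArg _ (ContinuousAlternatingMap.vecCons_smul (α x) ![u] c v))

theorem DForm.bilin_apply (α : DForm E M 2) (x : M) (u v : TangentSpace 𝓘(ℝ, E) x) :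
    α x ![u, v] = α.bilin x u v := rfl

theorem pullback_apply_two {F : Type*} [NormedAddCommGroup F] [NormedSpace ℝ F]
    {N : Type*} [TopologicalSpace N] [ChartedSpace F N]
    (f : M → N) (α : DForm F N 2) (x : M) (u v : TangentSpace 𝓘(ℝ, E) x) :
    pullback f α x ![u, v] =
      α (f x) ![mfderiv 𝓘(ℝ, E) 𝓘(ℝ, F) f x u, mfderiv 𝓘(ℝ, E) 𝓘(ℝ, F) f x v] := by
  have : (fun i => mfderiv 𝓘(ℝ, E) 𝓘(ℝ, F) f x (![u, v] i)) =
      ![mfderiv 𝓘(ℝ, E) 𝓘(ℝ, F) f x u, mfderiv 𝓘(ℝ, E) 𝓘(ℝ, F) f x v] := by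
    funext i
    fin_cases i <;> rfl
  exact congrArg (α (f x)) this

end Linear

/-! ### The contact form along maps moved by the flow -/

section Reeb

variable {E : Type*} [NormedAddCommGroup E] [NormedSpace ℝ E]
  {X : Type*} [TopologicalSpace X] [ChartedSpace E X] [IsManifold 𝓘(ℝ, E) ∞ X]
  {F : Type*} [NormedAddCommGroup F] [NormedSpace ℝ F]
  {M : Type*} [TopologicalSpace M] [ChartedSpace F M]

/-- The differential of a real function, as a linear form on the tangent spaces. -/
noncomputable def differential (a : M → ℝ) (y : M) : TangentSpace 𝓘(ℝ, F) y →L[ℝ] ℝ :=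
  mfderiv 𝓘(ℝ, F) 𝓘(ℝ, ℝ) a y

/-- `η` along a map that is moved by the Reeb flow. -/
theorem RegularSasaki.η_mfderiv_flow (S : RegularSasaki E X) {a : M → ℝ} {b : M → X}
    (ha : ContMDiff 𝓘(ℝ, F) 𝓘(ℝ, ℝ) ∞ a) (hb : ContMDiff 𝓘(ℝ, F) 𝓘(ℝ, E) ∞ b)
    (y : M) (v : TangentSpace 𝓘(ℝ, F) y) :
    S.η (S.flow (a y) (b y)) ![mfderiv 𝓘(ℝ, F) 𝓘(ℝ, E) (fun z => S.flow (a z) (b z)) y v] =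
      differential a y v + S.η (b y) ![mfderiv 𝓘(ℝ, F) 𝓘(ℝ, E) b y v] := by
  have hΦ : MDifferentiableAt (𝓘(ℝ, ℝ).prod 𝓘(ℝ, E)) 𝓘(ℝ, E)
      (fun p : ℝ × X => S.flow p.1 p.2) (a y, b y) := (S.smooth_flow _).mdifferentiableAt (by simp)
  have ha' := (ha y).mdifferentiableAt (by simp)
  have hb' := (hb y).mdifferentiableAt (by simp)
  have h1 : mfderiv 𝓘(ℝ, F) 𝓘(ℝ, E) (fun z => S.flow (a z) (b z)) y v =
      mfderiv (𝓘(ℝ, ℝ).prod 𝓘(ℝ, E)) 𝓘(ℝ, E) (fun p : ℝ × X => S.flow p.1 p.2) (a y, b y)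
        ((differential a y v, mfderiv 𝓘(ℝ, F) 𝓘(ℝ, E) b y v) : ℝ × E) := by
    have := mfderiv_comp y (I' := 𝓘(ℝ, ℝ).prod 𝓘(ℝ, E)) (f := fun z => (a z, b z)) hΦ
      (ha'.prodMk hb')
    rw [ha'.mfderiv_prod hb'] at this
    exact congrArg (fun L : F →L[ℝ] E => L v) this
  -- The differential of the flow splits into a time part, along the Reeb field, and a space part,
  -- which preserves `η`.
  have h2 := mfderiv_prod_eq_add_apply hΦ
    (v := ((differential a y v, mfderiv 𝓘(ℝ, F) 𝓘(ℝ, E) b y v) : ℝ × E))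
  have h3 := (S.flow_reeb (b y) (a y)).mfderiv
  have h4 := congrFun (S.flow_η (a y)) (b y)
  have h5 := pullback_apply_one (S.flow (a y)) S.η (b y) (mfderiv 𝓘(ℝ, F) 𝓘(ℝ, E) b y v)
  rw [h4] at h5
  have h6 : mfderiv 𝓘(ℝ, ℝ) 𝓘(ℝ, E) (fun t => S.flow t (b y)) (a y)
      (differential a y v) =
      differential a y v • S.reeb (S.flow (a y) (b y)) := by
    rw [h3]; rfl
  have h7 : mfderiv 𝓘(ℝ, F) 𝓘(ℝ, E) (fun z => S.flow (a z) (b z)) y v =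
      differential a y v • S.reeb (S.flow (a y) (b y)) +
        mfderiv 𝓘(ℝ, E) 𝓘(ℝ, E) (S.flow (a y)) (b y) (mfderiv 𝓘(ℝ, F) 𝓘(ℝ, E) b y v) := by
    rw [← h6]; exact h1.trans h2
  rw [h7, h5, DForm.lin_apply, map_add, map_smul, ← DForm.lin_apply, S.η_reeb, smul_eq_mul, mul_one,
    ← DForm.lin_apply]

end Reeb

/-! ### Functoriality of pull-back -/

section Pullback

variable {E : Type*} [NormedAddCommGroup E] [NormedSpace ℝ E]
  {X : Type*} [TopologicalSpace X] [ChartedSpace E X]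
  {F : Type*} [NormedAddCommGroup F] [NormedSpace ℝ F]
  {W : Type*} [TopologicalSpace W] [ChartedSpace F W]

theorem Diff.d_surjective (h : Diff E X) (x : X) : Function.Surjective (Diff.d h x) :=
  (h.mfderivToContinuousLinearEquiv (by simp) x).surjective

theorem pullback_pullback {D : Type*} [NormedAddCommGroup D] [NormedSpace ℝ D]
    {N : Type*} [TopologicalSpace N] [ChartedSpace D N] {k : ℕ} {f : N → X} {g : X → W}
    (hf : ContMDiff 𝓘(ℝ, D) 𝓘(ℝ, E) ∞ f) (hg : ContMDiff 𝓘(ℝ, E) 𝓘(ℝ, F) ∞ g) (α : DForm F W k) :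
    pullback (E := D) f (pullback (E := E) g α) = pullback (g ∘ f) α := by
  funext x
  ext v
  refine congrArg (α (g (f x))) (funext fun i => ?_)
  rw [mfderiv_comp x ((hg _).mdifferentiableAt (by simp)) ((hf _).mdifferentiableAt (by simp))]
  rfl

theorem pullback_id {k : ℕ} (α : DForm F W k) : pullback (E := F) (id : W → W) α = α :=
  pullback_one α

theorem EndField.apply_congr (J : EndField F W) {p p' : W} (h : p = p') {u v : F} (huv : u = v) :
    (J p : F →L[ℝ] F) u = (J p' : F →L[ℝ] F) v := by
  subst h huv
  rfl

end Pullback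

/-! ### The Kähler quotient and lifting of diffeomorphisms -/

section Quotient

variable {E : Type*} [NormedAddCommGroup E] [NormedSpace ℝ E]
  {X : Type*} [TopologicalSpace X] [ChartedSpace E X] [IsManifold 𝓘(ℝ, E) ∞ X]
  {F : Type*} [NormedAddCommGroup F] [NormedSpace ℝ F]
  {W : Type*} [TopologicalSpace W] [ChartedSpace F W] [IsManifold 𝓘(ℝ, F) ∞ W]

theorem PseudoHermitian.eq_zero_of_dη (S : PseudoHermitian E X) {x : X}
    {u : TangentSpace 𝓘(ℝ, E) x} (hu : S.η x ![u] = 0) (h : ∀ v, extD S.η x ![u, v] = 0) :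
    u = 0 := by
  by_contra hne
  have := S.levi_pos x u hu hne
  rw [DForm.two_swap, h, neg_zero] at this
  exact lt_irrefl _ this

/-- The Reeb field is determined by `η`: the difference of the two sides lies in `ker η` and, as
`h_*` is onto, in the radical of `dη`, hence is zero by positivity of the Levi form. -/
theorem PseudoHermitian.d_reeb (S : PseudoHermitian E X) {h : Diff E X} {μ : ℝ}
    (hh : pullback h S.η = μ • S.η) (x : X) : h.d x (S.reeb x) = μ • S.reeb (h x) := by
  have h1 : ∀ v, S.η (h x) ![h.d x v] = μ * S.η x ![v] := fun v => by
    rw [← pullback_apply_one, hh]; rfl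
  have h2 : ∀ u v, extD S.η (h x) ![h.d x u, h.d x v] = μ * extD S.η x ![u, v] := fun u v => by
    rw [← pullback_apply_two, ← extD_pullback S.smooth_η h.contMDiff, hh, extD_smul]; rfl
  rw [← sub_eq_zero]
  refine S.eq_zero_of_dη ?_ fun w => ?_
  · rw [DForm.lin_apply, map_sub, map_smul, ← DForm.lin_apply, ← DForm.lin_apply, h1, S.η_reeb,
      S.η_reeb, smul_eq_mul, sub_self]
  · obtain ⟨v, rfl⟩ := h.d_surjective x w
    rw [DForm.bilin_apply, map_sub, map_smul, LinearMap.sub_apply, LinearMap.smul_apply,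
      ← DForm.bilin_apply, ← DForm.bilin_apply, h2, S.dη_reeb, S.dη_reeb, mul_zero, smul_zero,
      sub_zero]

variable {S : RegularSasaki E X} {K : KahlerStructure F W} {q : X → W}

namespace IsKahlerQuotient

theorem exists_trivialization [FiniteDimensional ℝ F] [T2Space W] [SecondCountableTopology W]
    (hq : IsKahlerQuotient S K q) :
    ∃ (s : X → ℝ) (σ : W → X), ContMDiff 𝓘(ℝ, E) 𝓘(ℝ, ℝ) ∞ s ∧ ContMDiff 𝓘(ℝ, F) 𝓘(ℝ, E) ∞ σ ∧
      (∀ t x, s (S.flow t x) = t + s x) ∧ (∀ w, q (σ w) = w) ∧ (∀ w, s (σ w) = 0) ∧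
      ∀ x, S.flow (s x) (σ (q x)) = x := by
  obtain ⟨s, hs, hsφ⟩ := hq.bundle.exists_equivariant
  obtain ⟨σ, hσ, h⟩ := hq.bundle.exists_section S.smooth_flow hs hsφ
  exact ⟨s, σ, hs, hσ, hsφ, h⟩

theorem mdifferentiableAt (hq : IsKahlerQuotient S K q) (x : X) :
    MDifferentiableAt 𝓘(ℝ, E) 𝓘(ℝ, F) q x :=
  (hq.bundle.smooth x).mdifferentiableAt (by simp)

theorem mfderiv_reeb (hq : IsKahlerQuotient S K q) (x : X) :
    mfderiv 𝓘(ℝ, E) 𝓘(ℝ, F) q x (S.reeb x) = 0 := by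
  have key : ∀ t, mfderiv 𝓘(ℝ, E) 𝓘(ℝ, F) q (S.flow t x) (S.reeb (S.flow t x)) = 0 := by
    intro t
    have h1 := (hq.mdifferentiableAt (S.flow t x)).hasMFDerivAt.comp t (S.flow_reeb x t)
    have h2 : q ∘ (fun t => S.flow t x) = fun _ => q x := funext fun t => hq.bundle.invariant t x
    rw [h2] at h1
    have h3 := hasMFDerivAt_unique h1 (hasMFDerivAt_const (q x) t)
    have h4 := congrArg (fun L : ℝ →L[ℝ] F => L 1) h3
    change mfderiv 𝓘(ℝ, E) 𝓘(ℝ, F) q (S.flow t x) ((1 : ℝ) • (S.reeb (S.flow t x))) = 0 at h4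
    rwa [one_smul] at h4
  have := key 0
  rwa [S.flow.map_zero_apply] at this

theorem dη_eq (hq : IsKahlerQuotient S K q) (x : X) (u v : TangentSpace 𝓘(ℝ, E) x) :
    extD S.η x ![u, v] =
      K.Ω (q x) ![mfderiv 𝓘(ℝ, E) 𝓘(ℝ, F) q x u, mfderiv 𝓘(ℝ, E) 𝓘(ℝ, F) q x v] := by
  rw [← pullback_apply_two, hq.curvature]

/-- Holomorphy on `ker η` extends to all vectors because the Reeb component is killed both by `J`
and by `q_*`. -/
theorem mfderiv_J (hq : IsKahlerQuotient S K q) (x : X) (v : TangentSpace 𝓘(ℝ, E) x) :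
    mfderiv 𝓘(ℝ, E) 𝓘(ℝ, F) q x (S.J x v) = K.J (q x) (mfderiv 𝓘(ℝ, E) 𝓘(ℝ, F) q x v) := by
  have h := hq.holomorphic x (v - S.η x ![v] • S.reeb x) (by
    rw [DForm.lin_apply, map_sub, map_smul, ← DForm.lin_apply, ← DForm.lin_apply, S.η_reeb,
      smul_eq_mul, mul_one, sub_self])
  simpa only [map_sub, map_smul, S.J_reeb, hq.mfderiv_reeb, map_zero, smul_zero, sub_zero] using h

/-- The difference `u - v` lies in `ker η`, and since `dη` factors through `q_*` it is also in the
radical of `dη`. -/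
theorem mfderiv_injective (hq : IsKahlerQuotient S K q) {x : X} {u v : TangentSpace 𝓘(ℝ, E) x}
    (hη : S.η x ![u] = S.η x ![v])
    (h : mfderiv 𝓘(ℝ, E) 𝓘(ℝ, F) q x u = mfderiv 𝓘(ℝ, E) 𝓘(ℝ, F) q x v) : u = v := by
  rw [← sub_eq_zero]
  refine S.eq_zero_of_dη ?_ fun w => ?_
  · rw [DForm.lin_apply, map_sub, ← DForm.lin_apply, ← DForm.lin_apply, hη, sub_self]
  · rw [hq.dη_eq, map_sub, h, sub_self, DForm.bilin_apply, map_zero, LinearMap.zero_apply]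

/-- Horizontal lifts of tangent vectors. -/
theorem exists_horizontal_lift [FiniteDimensional ℝ F] [T2Space W] [SecondCountableTopology W]
    (hq : IsKahlerQuotient S K q) (x : X) (v : TangentSpace 𝓘(ℝ, F) (q x)) :
    ∃ u, S.η x ![u] = 0 ∧ mfderiv 𝓘(ℝ, E) 𝓘(ℝ, F) q x u = v := by
  obtain ⟨s, σ, hs, hσ, hsφ, hqσ, -, hσq⟩ := hq.exists_trivialization
  -- Translating `σ` by time `s x` gives a section through `x`, whose differential is a right
  -- inverse of `q_*` there.
  have hsurj : ∀ w, Function.Surjective (mfderiv 𝓘(ℝ, E) 𝓘(ℝ, F) q (S.flow (s x) (σ w))) := by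
    intro w z
    have hτ : ContMDiff 𝓘(ℝ, F) 𝓘(ℝ, E) ∞ fun w => S.flow (s x) (σ w) :=
      S.smooth_flow.comp (contMDiff_const.prodMk hσ)
    have h1 : q ∘ (fun w => S.flow (s x) (σ w)) = id :=
      funext fun w => (hq.bundle.invariant _ _).trans (hqσ w)
    have h2 := mfderiv_comp w (hq.mdifferentiableAt _) ((hτ w).mdifferentiableAt (by simp))
    rw [h1, mfderiv_id] at h2
    exact ⟨_, (congrArg (fun L : F →L[ℝ] F => L z) h2).symm⟩
  have hx := hsurj (q x)
  rw [hσq] at hx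
  obtain ⟨u, rfl⟩ := hx v
  refine ⟨u - S.η x ![u] • S.reeb x, ?_, ?_⟩
  · rw [DForm.lin_apply, map_sub, map_smul, ← DForm.lin_apply, ← DForm.lin_apply, S.η_reeb,
      smul_eq_mul, mul_one, sub_self]
  · rw [map_sub, map_smul, hq.mfderiv_reeb, smul_zero, sub_zero]

/-- A diffeomorphism of the quotient that multiplies the Kähler form by `μ = ±1` has a lift that
multiplies the contact form by `μ`. -/
theorem exists_lift [FiniteDimensional ℝ F] [T2Space W] [SecondCountableTopology W]
    (hq : IsKahlerQuotient S K q) (hH : closedOneForms F W ≤ exactOneForms F W)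
    {μ : ℝ} (hμ : μ * μ = 1) {h : Diff F W} (hh : pullback h K.Ω = μ • K.Ω) :
    ∃ h' : Diff E X, (∀ x, q (h' x) = h (q x)) ∧ pullback h' S.η = μ • S.η := by
  obtain ⟨s, σ, hs, hσ, hsφ, hqσ, hsσ, hσq⟩ := hq.exists_trivialization
  set β : DForm F W 1 := pullback σ S.η with hβ
  have hβs : IsSmoothForm β := S.smooth_η.pullback hσ
  have hβd : extD β = K.Ω := by
    rw [hβ, extD_pullback S.smooth_η hσ, ← hq.curvature, pullback_pullback hσ hq.bundle.smooth,
      show q ∘ σ = id from funext hqσ, pullback_id]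
  have hclosed : pullback h β + (-μ) • β ∈ closedOneForms F W := by
    have h1 : IsSmoothForm (pullback (E := F) h β) := hβs.pullback h.contMDiff
    have h2 : IsSmoothForm ((-μ) • β) := fun x => by
      rw [formInChart_smul]; exact contDiffOn_const.smul (hβs x)
    refine ⟨fun x => by rw [formInChart_add]; exact (h1 x).add (h2 x), ?_⟩
    rw [extD_add h1 h2, extD_pullback hβs h.contMDiff, extD_smul, hβd, hh]
    funext w
    ext v
    change μ * K.Ω w v + -μ * K.Ω w v = 0
    ring
  obtain ⟨l, hl, hl'⟩ := hH hclosed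
  have hlβ : ∀ w (v : TangentSpace 𝓘(ℝ, F) w),
      β (h w) ![h.d w v] - μ * β w ![v] = differential l w v := fun w v => by
    rw [← pullback_apply_one, sub_eq_add_neg, ← neg_mul]
    exact hl' w v
  -- In coordinates `(s, w)`, `f` is `(μ s - l w, h w)`. Solving for the source with `μ² = 1` gives
  -- the inverse `g`.
  let f : X → X := fun x => S.flow (μ * s x - l (q x)) (σ (h (q x)))
  let g : X → X := fun x => S.flow (μ * (s x + l (h.symm (q x)))) (σ (h.symm (q x)))
  have ha : ContMDiff 𝓘(ℝ, E) 𝓘(ℝ, ℝ) ∞ fun x => μ * s x - l (q x) :=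
    (contMDiff_const.mul hs).sub (hl.comp hq.bundle.smooth)
  have hb : ContMDiff 𝓘(ℝ, E) 𝓘(ℝ, E) ∞ fun x => σ (h (q x)) :=
    hσ.comp (h.contMDiff.comp hq.bundle.smooth)
  have hf : ContMDiff 𝓘(ℝ, E) 𝓘(ℝ, E) ∞ f := S.smooth_flow.comp (ha.prodMk hb)
  have hlinv : ContMDiff 𝓘(ℝ, E) 𝓘(ℝ, F) ∞ fun x => h.symm (q x) :=
    h.symm.contMDiff.comp hq.bundle.smooth
  have hg : ContMDiff 𝓘(ℝ, E) 𝓘(ℝ, E) ∞ g := S.smooth_flow.comp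
    ((contMDiff_const.mul (hs.add (hl.comp hlinv))).prodMk (hσ.comp hlinv))
  have hqf : ∀ x, q (f x) = h (q x) := fun x => (hq.bundle.invariant _ _).trans (hqσ _)
  have hqg : ∀ x, q (g x) = h.symm (q x) := fun x => (hq.bundle.invariant _ _).trans (hqσ _)
  have hsf : ∀ x, s (f x) = μ * s x - l (q x) := fun x => by
    rw [hsφ, hsσ, add_zero]
  have hsg : ∀ x, s (g x) = μ * (s x + l (h.symm (q x))) := fun x => by
    rw [hsφ, hsσ, add_zero]
  refine ⟨⟨⟨f, g, fun x => ?_, fun x => ?_⟩, hf, hg⟩, hqf, ?_⟩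
  · change S.flow (μ * (s (f x) + l (h.symm (q (f x))))) (σ (h.symm (q (f x)))) = x
    rw [hqf, h.symm_apply_apply, hsf, sub_add_cancel, ← mul_assoc, hμ, one_mul, hσq]
  · change S.flow (μ * s (g x) - l (q (g x))) (σ (h (q (g x)))) = x
    rw [hqg, h.apply_symm_apply, hsg, ← mul_assoc, hμ, one_mul, add_sub_cancel_right, hσq]
  · funext x
    ext v
    obtain ⟨v, rfl⟩ : ∃ u, v = ![u] := ⟨v 0, funext fun i => by rw [Subsingleton.elim i 0]; rfl⟩
    rw [pullback_apply_one]
    change S.η (f x) ![mfderiv 𝓘(ℝ, E) 𝓘(ℝ, E) f x v] = μ * S.η x ![v]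
    have hqx := hq.mdifferentiableAt x
    have e1 := S.η_mfderiv_flow ha hb x v
    -- Applied to the identity written as `x ↦ φ_{s x} (σ (q x))`, this yields `η = ds + q^*β`.
    have e2 := S.η_mfderiv_flow hs (hσ.comp hq.bundle.smooth) x v
    have e3 : S.η (S.flow (s x) ((σ ∘ q) x))
        ![mfderiv 𝓘(ℝ, E) 𝓘(ℝ, E) (fun z => S.flow (s z) ((σ ∘ q) z)) x v] = S.η x ![v] := by
      refine DForm.eval_congr S.η (hσq x) (congrArg (fun u : E => ![u]) ?_)
      have : (fun z => S.flow (s z) ((σ ∘ q) z)) = id := funext hσq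
      rw [this, mfderiv_id]
      rfl
    have e4 : S.η ((σ ∘ q) x) ![mfderiv 𝓘(ℝ, E) 𝓘(ℝ, E) (σ ∘ q) x v] =
        β (q x) ![mfderiv 𝓘(ℝ, E) 𝓘(ℝ, F) q x v] := by
      rw [hβ, pullback_apply_one, mfderiv_comp x ((hσ _).mdifferentiableAt (by simp)) hqx]
      rfl
    have e5 : S.η (σ (h (q x))) ![mfderiv 𝓘(ℝ, E) 𝓘(ℝ, E) (fun x => σ (h (q x))) x v] =
        β (h (q x)) ![h.d (q x) (mfderiv 𝓘(ℝ, E) 𝓘(ℝ, F) q x v)] := by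
      rw [hβ, pullback_apply_one]
      have := mfderiv_comp x (g := σ) (f := h ∘ q) ((hσ _).mdifferentiableAt (by simp))
        (((h.contMDiff.comp hq.bundle.smooth) x).mdifferentiableAt (by simp))
      rw [mfderiv_comp x ((h.contMDiff _).mdifferentiableAt (by simp)) hqx] at this
      change S.η (σ (h (q x))) ![mfderiv 𝓘(ℝ, E) 𝓘(ℝ, E) (σ ∘ h ∘ q) x v] = _
      rw [this]
      rfl
    have e6 : differential (fun x => μ * s x - l (q x)) x v =
        μ * differential s x v - differential l (q x) (mfderiv 𝓘(ℝ, E) 𝓘(ℝ, F) q x v) := by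
      have d1 := ((hs x).mdifferentiableAt (by simp)).hasMFDerivAt.const_smul μ
      have d2 := ((hl (q x)).mdifferentiableAt (by simp)).hasMFDerivAt.comp x hqx.hasMFDerivAt
      exact congrArg (fun L : E →L[ℝ] ℝ => L v) (d1.sub d2).mfderiv
    have e7 := hlβ (q x) (mfderiv 𝓘(ℝ, E) 𝓘(ℝ, F) q x v)
    have e8 := e1.trans (congrArg₂ (· + ·) e6 e5)
    rw [e3, e4] at e2
    refine e8.trans ?_
    rw [e2, ← e7]
    ring

end IsKahlerQuotient

end Quotient

/-! ### Isometries, descent and the kernel -/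

section Isometries

variable {E : Type*} [NormedAddCommGroup E] [NormedSpace ℝ E]
  {X : Type*} [TopologicalSpace X] [ChartedSpace E X] [IsManifold 𝓘(ℝ, E) ∞ X]
  {F : Type*} [NormedAddCommGroup F] [NormedSpace ℝ F]
  {W : Type*} [TopologicalSpace W] [ChartedSpace F W] [IsManifold 𝓘(ℝ, F) ∞ W]

theorem KahlerStructure.eq_of_Ω (K : KahlerStructure F W) {w : W} {u v : TangentSpace 𝓘(ℝ, F) w}
    (h : ∀ z, K.Ω w ![u, z] = K.Ω w ![v, z]) : u = v := by
  rw [← sub_eq_zero]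
  by_contra hne
  have := K.pos w _ hne
  rw [DForm.two_swap, DForm.bilin_apply, map_sub, LinearMap.sub_apply, ← DForm.bilin_apply,
    ← DForm.bilin_apply, h, sub_self, neg_zero] at this
  exact lt_irrefl _ this

/-- An isometry of a Kähler manifold with `h^* Ω = μ Ω` satisfies `h_* J = μ J h_*`. -/
theorem KahlerStructure.d_J (K : KahlerStructure F W) {h : Diff F W} {μ : ℝ}
    (hi : IsIsometryFor K.metric h) (hh : pullback h K.Ω = μ • K.Ω) (w : W)
    (v : TangentSpace 𝓘(ℝ, F) w) : h.d w (K.J w v) = μ • K.J (h w) (h.d w v) := by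
  refine K.eq_of_Ω fun z => ?_
  obtain ⟨z, rfl⟩ := h.d_surjective w z
  have h1 : K.Ω (h w) ![K.J (h w) (h.d w v), h.d w z] = K.Ω w ![K.J w v, z] := hi w v z
  have h2 : K.Ω (h w) ![h.d w (K.J w v), h.d w z] = μ * K.Ω w ![K.J w v, z] := by
    rw [← pullback_apply_two, hh]; rfl
  rw [h2, DForm.bilin_apply _ _ (μ • _), map_smul, LinearMap.smul_apply, ← DForm.bilin_apply, h1,
    smul_eq_mul]

/-- An isometry of a Kähler manifold with `h_* J = μ J h_*` satisfies `h^* Ω = μ Ω`. -/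
theorem KahlerStructure.pullback_Ω (K : KahlerStructure F W) {h : Diff F W} {μ : ℝ}
    (hi : IsIsometryFor K.metric h)
    (hJ : ∀ w v, h.d w (K.J w v) = μ • K.J (h w) (h.d w v)) : pullback h K.Ω = μ • K.Ω := by
  funext w
  ext v
  obtain ⟨u, z, rfl⟩ : ∃ u z, v = ![u, z] :=
    ⟨v 0, v 1, funext fun i => by fin_cases i <;> rfl⟩
  rw [pullback_apply_two]
  change K.Ω (h w) ![h.d w u, h.d w z] = μ * K.Ω w ![u, z]
  have hu : u = K.J w (-K.J w u) := by rw [map_neg, K.J_J, neg_neg]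
  have h1 : K.Ω (h w) ![K.J (h w) (h.d w (-K.J w u)), h.d w z] = K.Ω w ![K.J w (-K.J w u), z] :=
    hi w _ z
  rw [← hu] at h1
  rw [← h1]
  conv_lhs => rw [hu, hJ]
  rw [DForm.bilin_apply, map_smul, LinearMap.smul_apply, ← DForm.bilin_apply, smul_eq_mul]

/-- Pseudo-Hermitian transformations commute with the Reeb flow. -/
theorem RegularSasaki.map_flow [T2Space X] (S : RegularSasaki E X)
    {h : Diff E X} (hη : pullback h S.η = S.η) (t : ℝ) (x : X) :
    h (S.flow t x) = S.flow t (h x) := by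
  have : IsManifold 𝓘(ℝ, E) 1 X := .of_le (n := ∞) (by simp)
  have h1 : IsMIntegralCurve (I := 𝓘(ℝ, E)) (fun t => h (S.flow t x)) S.reeb := by
    intro t
    have h2 := (h.mdifferentiable (by simp) (S.flow t x)).hasMFDerivAt.comp t (S.flow_reeb x t)
    have h3 := S.d_reeb (μ := 1) (h := h) (by rw [hη, one_smul]) (S.flow t x)
    rw [one_smul] at h3
    refine h2.congr_mfderiv ?_
    ext
    change h.d (S.flow t x) ((1 : ℝ) • S.reeb (S.flow t x)) = (1 : ℝ) • S.reeb (h (S.flow t x))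
    rw [one_smul, one_smul, h3]
  -- Both curves are integral curves of the Reeb field starting at `h x`.
  have h4 := isMIntegralCurve_Ioo_eq_of_contMDiff_boundaryless (t₀ := 0)
    (S.smooth_reeb.of_le (by simp)) h1 (S.flow_reeb (h x))
    (by rw [S.flow.map_zero_apply, S.flow.map_zero_apply])
  exact congrFun h4 t

variable {S : RegularSasaki E X} {K : KahlerStructure F W} {q : X → W}

namespace IsKahlerQuotient

theorem mfderiv_lift (hq : IsKahlerQuotient S K q) {h' : Diff E X} {h : Diff F W}
    (hh : ∀ x, q (h' x) = h (q x)) (x : X) (v : TangentSpace 𝓘(ℝ, E) x) :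
    (mfderiv 𝓘(ℝ, E) 𝓘(ℝ, F) q (h' x) (h'.d x v) : F) =
      h.d (q x) (mfderiv 𝓘(ℝ, E) 𝓘(ℝ, F) q x v) := by
  have h1 : q ∘ h' = h ∘ q := funext hh
  have h2 := mfderiv_comp x (hq.mdifferentiableAt (h' x)) (h'.mdifferentiable (by simp) x)
  rw [h1] at h2
  have h3 := mfderiv_comp x (h.mdifferentiable (by simp) (q x)) (hq.mdifferentiableAt x)
  exact congrArg (fun L : E →L[ℝ] F => L v) (h2.symm.trans h3)

/-- The Levi form at `h' x` in terms of the metric of the quotient, for a lift `h'` of `h`. -/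
theorem levi_lift (hq : IsKahlerQuotient S K q) {h' : Diff E X} {h : Diff F W}
    (hh : ∀ x, q (h' x) = h (q x)) (x : X) (u v : TangentSpace 𝓘(ℝ, E) x) :
    extD S.η (h' x) ![S.J (h' x) (h'.d x u), h'.d x v] =
      K.metric (h (q x)) (h.d (q x) (mfderiv 𝓘(ℝ, E) 𝓘(ℝ, F) q x u))
        (h.d (q x) (mfderiv 𝓘(ℝ, E) 𝓘(ℝ, F) q x v)) := by
  rw [hq.dη_eq, hq.mfderiv_J]
  refine DForm.eval_congr K.Ω (hh x) ?_
  exact congrArg₂ (fun a b : F => ![a, b]) (K.J.apply_congr (hh x) (hq.mfderiv_lift hh x u))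
    (hq.mfderiv_lift hh x v)

theorem levi_eq (hq : IsKahlerQuotient S K q) (x : X) (u v : TangentSpace 𝓘(ℝ, E) x) :
    extD S.η x ![S.J x u, v] = K.metric (q x) (mfderiv 𝓘(ℝ, E) 𝓘(ℝ, F) q x u)
        (mfderiv 𝓘(ℝ, E) 𝓘(ℝ, F) q x v) := by
  rw [hq.dη_eq, hq.mfderiv_J]; rfl

/-- The metric is `η · η` plus the Levi form: the first changes by `μ² = 1`, the second is induced
from the metric of `W`, which `h` preserves. -/
theorem lift_mem_PshPM (hq : IsKahlerQuotient S K q) {h' : Diff E X} {h : Diff F W}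
    (hh : ∀ x, q (h' x) = h (q x)) {μ : ℝ} (hμ : μ = 1 ∨ μ = -1)
    (hi : IsIsometryFor K.metric h) (hη : pullback h' S.η = μ • S.η) : h' ∈ S.PshPM := by
  have hμ2 : μ * μ = 1 := by rcases hμ with rfl | rfl <;> norm_num
  have h1 : ∀ x v, S.η (h' x) ![h'.d x v] = μ * S.η x ![v] := fun x v => by
    rw [← pullback_apply_one, hη]; rfl
  refine ⟨fun x u v => ?_, ?_⟩
  · simp only [PseudoHermitian.metric]
    rw [hq.levi_lift hh, hi, hq.levi_eq, h1, h1]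
    linear_combination (S.η x ![u] * S.η x ![v]) * hμ2
  · rcases hμ with rfl | rfl
    · exact Or.inl fun x => by rw [S.d_reeb hη, one_smul]
    · exact Or.inr fun x => by rw [S.d_reeb hη, neg_one_smul]

/-- The two vectors to be compared are both in `ker η`, and they have the same image in `W` because
`h` is holomorphic. -/
theorem lift_mem_Psh (hq : IsKahlerQuotient S K q) {h' : Diff E X} {h : Diff F W}
    (hh : ∀ x, q (h' x) = h (q x)) (hJ : ∀ w v, h.d w (K.J w v) = K.J (h w) (h.d w v))
    (hη : pullback h' S.η = S.η) : h' ∈ S.Psh := by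
  refine ⟨hη, fun x v hv => hq.mfderiv_injective ?_ ?_⟩
  · rw [S.η_J, ← pullback_apply_one, hη, S.η_J]
  · have h1 := hq.mfderiv_lift hh x (S.J x v)
    rw [hq.mfderiv_J, hJ] at h1
    rw [hq.mfderiv_J]
    exact h1.trans (K.J.apply_congr (hh x) (hq.mfderiv_lift hh x v)).symm

variable [FiniteDimensional ℝ F] [T2Space W] [SecondCountableTopology W]

theorem exists_descent [T2Space X] (hq : IsKahlerQuotient S K q) {h' : Diff E X}
    (hh' : h' ∈ S.Psh) : ∃ h ∈ K.IsomH, ∀ x, q (h' x) = h (q x) := by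
  obtain ⟨s, σ, hs, hσ, hsφ, hqσ, -, hσq⟩ := hq.exists_trivialization
  -- `σ (q x)` lies on the orbit of `x`, and `k` maps orbits to orbits; so `q ∘ k ∘ σ` is the
  -- descended map.
  have key : ∀ k ∈ S.Psh, ∀ x, q (k (σ (q x))) = q (k x) := fun k hk x => by
    conv_rhs => rw [← hσq x]
    rw [S.map_flow hk.1, hq.bundle.invariant]
  have hinv := S.Psh.inv_mem hh'
  have hsm : ∀ k : Diff E X, ContMDiff 𝓘(ℝ, F) 𝓘(ℝ, F) ∞ fun w => q (k (σ w)) := fun k =>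
    hq.bundle.smooth.comp (k.contMDiff.comp hσ)
  let h : Diff F W :=
    { toFun := fun w => q (h' (σ w))
      invFun := fun w => q (h'⁻¹ (σ w))
      left_inv := fun w => by
        refine (key _ hinv _).trans ?_
        exact (congrArg q (h'.symm_apply_apply (σ w))).trans (hqσ w)
      right_inv := fun w => by
        refine (key _ hh' _).trans ?_
        exact (congrArg q (h'.apply_symm_apply (σ w))).trans (hqσ w)
      contMDiff_toFun := hsm h'
      contMDiff_invFun := hsm h'⁻¹ }
  have hh : ∀ x, q (h' x) = h (q x) := fun x => (key _ hh' x).symm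
  refine ⟨h, ⟨fun w u v => ?_, fun w v => ?_⟩, hh⟩
  · obtain ⟨x, rfl⟩ := hq.bundle.surjective w
    obtain ⟨u, hu, rfl⟩ := hq.exists_horizontal_lift x u
    obtain ⟨v, hv, rfl⟩ := hq.exists_horizontal_lift x v
    rw [← hq.levi_lift hh, ← hq.levi_eq, ← hh'.2 x u hu, ← pullback_apply_two,
      ← extD_pullback S.smooth_η h'.contMDiff, hh'.1]
  · obtain ⟨x, rfl⟩ := hq.bundle.surjective w
    obtain ⟨v, hv, rfl⟩ := hq.exists_horizontal_lift x v
    have h1 := hq.mfderiv_lift hh x (S.J x v)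
    rw [hq.mfderiv_J, hh'.2 x v hv, hq.mfderiv_J] at h1
    exact h1.symm.trans (K.J.apply_congr (hh x) (hq.mfderiv_lift hh x v))

/-- A pseudo-Hermitian transformation over the identity belongs to the Reeb flow. -/
theorem exists_flow_of_lift_id [ConnectedSpace X] (hq : IsKahlerQuotient S K q) {h : Diff E X}
    (hη : pullback h S.η = S.η) (hh : ∀ x, q (h x) = q x) : ∃ t, ∀ x, S.flow t x = h x := by
  obtain ⟨s, σ, hs, hσ, hsφ, hqσ, -, hσq⟩ := hq.exists_trivialization
  have hf : ContMDiff 𝓘(ℝ, E) 𝓘(ℝ, ℝ) ∞ fun x => s (h x) - s x := (hs.comp h.contMDiff).sub hs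
  have hfl : ∀ x, S.flow (s (h x) - s x) x = h x := fun x => by
    conv_rhs => rw [← hσq (h x), hh]
    conv_lhs => rw [← hσq x]
    rw [← S.flow.map_add, hσq x, sub_add_cancel]
  -- With `h x = φ_{f x} x`, the formula `h^*η = η + df` and the invariance of `η` give `df = 0`.
  have hconst := eq_of_mfderiv_eq_zero hf fun x v => by
    have h1 := S.η_mfderiv_flow hf contMDiff_id x v
    have h2 : S.η (S.flow (s (h x) - s x) (id x))
        ![mfderiv 𝓘(ℝ, E) 𝓘(ℝ, E) (fun x => S.flow (s (h x) - s x) (id x)) x v] = S.η x ![v] := by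
      rw [← congrFun hη x, pullback_apply_one]
      refine DForm.eval_congr S.η (hfl x) (congrArg (fun u : E => ![u]) ?_)
      rw [show (fun x => S.flow (s (h x) - s x) (id x)) = h from funext hfl]
      rfl
    have h3 : S.η (id x) ![mfderiv 𝓘(ℝ, E) 𝓘(ℝ, E) id x v] = S.η x ![v] := by
      rw [mfderiv_id]; rfl
    rw [h2, h3] at h1
    exact left_eq_add.1 (h1.trans (add_comm _ _))
  obtain ⟨x₀⟩ := (inferInstance : Nonempty X)
  exact ⟨s (h x₀) - s x₀, fun x => by rw [← hfl x, hconst x x₀]⟩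

end IsKahlerQuotient

end Isometries

end SasakiGeometry

/-! ### The exact sequence, transitivity and lifts -/

theorem mainTheorem8
    {E : Type*} [NormedAddCommGroup E] [NormedSpace ℝ E] [FiniteDimensional ℝ E]
    {X : Type*} [TopologicalSpace X] [ChartedSpace E X] [IsManifold 𝓘(ℝ, E) ∞ X]
    [T2Space X] [SecondCountableTopology X] [ConnectedSpace X]
    {F : Type*} [NormedAddCommGroup F] [NormedSpace ℝ F] [FiniteDimensional ℝ F]
    {W : Type*} [TopologicalSpace W] [ChartedSpace F W] [IsManifold 𝓘(ℝ, F) ∞ W]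
    [T2Space W] [SecondCountableTopology W]
    (S : RegularSasaki E X) (K : KahlerStructure F W) (q : X → W)
    (hq : IsKahlerQuotient S K q)
    (hH : Subsingleton (DeRhamH1 F W)) :
    -- the Boothby-Wang homomorphism and the exact sequence `1 → ℝ → Psh (X) → Isom_h (W) → 1`
    (∃ φ : S.Psh →* K.IsomH,
      (∀ (h : S.Psh) (x : X), q (h.1 x) = (φ h).1 (q x)) ∧
      (∀ ψ : S.Psh →* K.IsomH,
        (∀ (h : S.Psh) (x : X), q (h.1 x) = (ψ h).1 (q x)) → ψ = φ) ∧
      Function.Injective S.reebHom ∧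
      S.reebHom.range = φ.ker ∧
      Function.Surjective φ) ∧
    -- transitivity
    ((∀ x y : X, ∃ h ∈ S.Psh, h x = y) ↔ (∀ w z : W, ∃ h ∈ K.IsomH, h w = z)) ∧
    -- lifting of isometries with `h^* Ω = μ Ω`
    (∀ (μ : ℝ) (h : Diff F W), (μ = 1 ∨ μ = -1) → IsIsometryFor K.metric h →
      pullback h K.Ω = μ • K.Ω →
      ∃ h' ∈ S.PshPM, (∀ x, q (h' x) = h (q x)) ∧ pullback h' S.η = μ • S.η ∧
        (μ = 1 → h' ∈ S.Psh)) ∧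
    -- holomorphic and anti-holomorphic isometries lift
    (∀ h ∈ K.IsomHPM, ∃ h' ∈ S.PshPM, (∀ x, q (h' x) = h (q x)) ∧
      (h ∈ K.IsomH → h' ∈ S.Psh)) := by
  have hsurj := hq.bundle.surjective
  have hlift : ∀ (μ : ℝ) (h : Diff F W), (μ = 1 ∨ μ = -1) → IsIsometryFor K.metric h →
      pullback h K.Ω = μ • K.Ω →
      ∃ h' ∈ S.PshPM, (∀ x, q (h' x) = h (q x)) ∧ pullback h' S.η = μ • S.η ∧
        (μ = 1 → h' ∈ S.Psh) := by
    intro μ h hμ hi hΩ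
    have hμ2 : μ * μ = 1 := by rcases hμ with rfl | rfl <;> norm_num
    obtain ⟨h', hh, hη⟩ := hq.exists_lift ((subsingleton_deRhamH1_iff F W).1 hH) hμ2 hΩ
    refine ⟨h', hq.lift_mem_PshPM hh hμ hi hη, hh, hη, ?_⟩
    rintro rfl
    refine hq.lift_mem_Psh hh (fun w v => ?_) (by rw [hη, one_smul])
    rw [K.d_J hi hΩ, one_smul]
  have hliftH : ∀ h ∈ K.IsomH, ∃ h' ∈ S.PshPM, (∀ x, q (h' x) = h (q x)) ∧ h' ∈ S.Psh := by
    intro h hh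
    obtain ⟨h', hpm, hq', -, hpsh⟩ := hlift 1 h (Or.inl rfl) hh.1
      (K.pullback_Ω hh.1 fun w v => by rw [hh.2, one_smul])
    exact ⟨h', hpm, hq', hpsh rfl⟩
  -- As `q` is onto, a descended map is unique; the homomorphism laws and the uniqueness of `φ`
  -- reduce to this.
  have hext : ∀ k k' : K.IsomH, (∀ x, k.1 (q x) = k'.1 (q x)) → k = k' := fun k k' h =>
    Subtype.ext (Diffeomorph.ext fun w => by obtain ⟨x, rfl⟩ := hsurj w; exact h x)
  refine ⟨?_, ⟨fun h w z => ?_, fun h x y => ?_⟩, hlift, ?_⟩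
  · choose φ hφ hqφ using fun h : S.Psh => hq.exists_descent h.2
    refine ⟨⟨⟨fun h => ⟨φ h, hφ h⟩, hext _ _ fun x => (hqφ 1 x).symm⟩, fun f g => hext _ _ fun x => ?_⟩,
      hqφ, fun ψ hψ => ?_, fun s t hst => ?_, ?_, fun h => ?_⟩
    · refine (hqφ (f * g) x).symm.trans ((hqφ f (g.1 x)).trans ?_)
      exact congrArg (φ f) (hqφ g x)
    · exact MonoidHom.ext fun h => hext _ _ fun x => (hψ h x).symm.trans (hqφ h x)
    · have h1 : ∀ x, S.flow s.toAdd x = S.flow t.toAdd x := fun x =>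
        congrArg (fun h : S.Psh => h.1 x) hst
      have h2 := S.flow_line (-t.toAdd + s.toAdd) fun x => by
        rw [S.flow.map_add, h1, ← S.flow.map_add, neg_add_cancel, S.flow.map_zero_apply]
      exact Multiplicative.toAdd.injective (neg_add_eq_zero.1 h2).symm
    · ext h
      rw [MonoidHom.mem_range, MonoidHom.mem_ker]
      constructor
      · rintro ⟨t, rfl⟩
        exact hext _ _ fun x => (hqφ _ x).symm.trans (hq.bundle.invariant t.toAdd x)
      · intro hh
        obtain ⟨t, ht⟩ := hq.exists_flow_of_lift_id h.2.1 fun x =>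
          (hqφ h x).trans (congrArg (fun k : K.IsomH => k.1 (q x)) hh)
        exact ⟨Multiplicative.ofAdd t, Subtype.ext (Diffeomorph.ext ht)⟩
    · obtain ⟨h', -, hq', hh'⟩ := hliftH h.1 h.2
      exact ⟨⟨h', hh'⟩, hext _ _ fun x => (hqφ ⟨h', hh'⟩ x).symm.trans (hq' x)⟩
  · obtain ⟨x, rfl⟩ := hsurj w
    obtain ⟨y, rfl⟩ := hsurj z
    obtain ⟨h', hh', rfl⟩ := h x y
    obtain ⟨k, hk, hqk⟩ := hq.exists_descent hh'
    exact ⟨k, hk, (hqk x).symm⟩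
  · obtain ⟨k, hk, hkx⟩ := h (q x) (q y)
    obtain ⟨h', -, hq', hh'⟩ := hliftH k hk
    -- The lift of `k` takes `x` into the fibre of `y`; a time-`t` Reeb translation moves it to `y`
    -- itself.
    obtain ⟨t, ht⟩ := hq.bundle.exists_flow_eq ((hq' x).trans hkx)
    exact ⟨_, S.Psh.mul_mem (S.reebHom (Multiplicative.ofAdd t)).2 hh', ht⟩
  · rintro h ⟨hi, hJ⟩
    -- The split is on holomorphy, not on the disjunction `hJ`: in dimension zero both alternatives
    -- hold, and the lift must then be the one in `Psh`.
    by_cases hh : h ∈ K.IsomH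
    · obtain ⟨h', hpm, hq', hpsh⟩ := hliftH h hh
      exact ⟨h', hpm, hq', fun _ => hpsh⟩
    · have hJ' := hJ.resolve_left fun hJ => hh ⟨hi, hJ⟩
      obtain ⟨h', hpm, hq', -⟩ := hlift (-1) h (Or.inr rfl) hi
        (K.pullback_Ω hi fun w v => by rw [hJ', neg_one_smul])
      exact ⟨h', hpm, hq', fun h => absurd h hh⟩
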